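/- Let $\pi:E\to M$ be a smooth vector bundle over a smooth manifold, both modelled on real Banach spaces. Write $\tau_E:TE\to E$ for the tangent bundle and $+_\tau,\ \cdot_\tau$ for the operations of the vector bundle $T\pi:TE\to TM$, i.e. the tangent maps of the fibrewise addition and scalar multiplication of $E$. For $v,w\in TE$ with $T\pi(v)=T\pi(w)$ put $\xi^V_{T\pi}(v,w)=\frac{d}{ds}\big(v+_\tau s\cdot_\tau w\big)\big|_{s=0}\in \mathrm{Ver}(T\pi)\subset T(TE)$, and let $\nu_{T\pi}:\mathrm{Ver}(T\pi)\to TE$ be the map with $\nu_{T\pi}(\xi^V_{T\pi}(v,w))=w$. Let $\pi^*E=\{(a,b)\in E\times E\mid \pi(a)=\pi(b)\}$, a vector bundle over $E$ by $(a,b)\mapsto a$, and identify $T(\pi^*E)$ with $\{(w_1,w_2)\in TE\times TE\mid T\pi(w_1)=T\pi(w_2)\}$. Let $C\subset E$ be a submanifold such that $C\cap \pi^{-1}(m)$ is a nonempty open subset of $E_m=\pi^{-1}(m)$ for every $m\in M$, and let $\xi^H$ be the horizontal lift of a nonlinear connection on $\pi$ that is smooth on $C$: for $a\in C$ the map $\xi^H(a,\cdot):T_{\pi(a)}M\to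 T_aE$ is linear with $T\pi(\xi^H(a,v))=v$, and $(a,v)\mapsto \xi^H(a,v)$ is smooth on $\{(a,v)\in\pi^*TM\mid a\in C\}$. (Outside $C$ nothing is assumed.) For $a\in C$, $b\in E_{\pi(a)}$ and $w\in T_aE$ let $$B(a,b)w=\nu_{T\pi}\Big(\frac{d}{ds}\,\xi^H\big(a+sb,\,T\pi(w)\big)\Big|_{s=0}\Big).$$ Then $B(a,b)w$ is well defined (the curve is differentiable at $s=0$ and its velocity is the vertical lift of a unique element of $TE$), $B(a,b)w\in T_bE$ and $T\pi(B(a,b)w)=T\pi(w)$. Moreover the map $\xi^{\bar H}((a,b),w)=(w,B(a,b)w)\in T_{(a,b)}(\pi^*E)$ is the horizontal lift of a linear connection on the vector bundle $\pi^*E\to E$ with domain $\pi_C^*E=\{(a,b)\in\pi^*E\mid a\in C\}$. That is, for $a\in C$ it is linear in $w\in T_aE$ and projects to $w$; it is smooth on the set of all $((a,b),w)$ with $a\in C$ and $w\in T_aE$; and for $a\in C$, $b,b'\in E_{\pi(a)}$, $\lambda\in\mathbb R$ and $w\in T_aE$, $$\xi^{\bar H}((a,b+b'),w)=\xi^{\bar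 H}((a,b),w)+_\tau\xi^{\bar H}((a,b'),w),\qquad \xi^{\bar H}((a,\lambda b),w)=\lambda\cdot_\tau\xi^{\bar H}((a,b),w),$$ where $+_\tau$ and $\cdot_\tau$ are now the operations induced on $T(\pi^*E)$ by the vector bundle $\pi^*E\to E$. -/

import Mathlib

open Bundle Set
open scoped Manifold ContDiff Topology

noncomputable section

/-! ### Submanifolds and velocities -/

/-- `S ⊆ N` is an (embedded, split) submanifold of the smooth Banach manifold `N`: around each of
its points there is a smooth chart of `N` in which `S` is the trace of a closed complemented
subspace of the model space. -/
def IsSubmanifold {EN HN N : Type*} [NormedAddCommGroup EN] [NormedSpace ℝ EN]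
    [TopologicalSpace HN] (J : ModelWithCorners ℝ EN HN) [TopologicalSpace N] [ChartedSpace HN N]
    (S : Set N) : Prop :=
  ∀ x ∈ S, ∃ φ ∈ IsManifold.maximalAtlas J ∞ N, x ∈ φ.source ∧
    ∃ A : Submodule ℝ EN, A.ClosedComplemented ∧
      ∀ y ∈ φ.source, (y ∈ S ↔ φ.extend J y ∈ A)

/-- The velocity at time `0` of a curve `γ : ℝ → N`, as a point of the tangent bundle of `N`. -/
def velocity {EN HN N : Type*} [NormedAddCommGroup EN] [NormedSpace ℝ EN]
    [TopologicalSpace HN] (J : ModelWithCorners ℝ EN HN) [TopologicalSpace N] [ChartedSpace HN N]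
    (γ : ℝ → N) : TangentBundle J N :=
  tangentMap 𝓘(ℝ, ℝ) J γ ⟨0, (1 : ℝ)⟩

section VectorBundleConnections

variable {EB : Type*} [NormedAddCommGroup EB] [NormedSpace ℝ EB]
  {HB : Type*} [TopologicalSpace HB] (I : ModelWithCorners ℝ EB HB)
  {M : Type*} [TopologicalSpace M] [ChartedSpace HB M] [IsManifold I ∞ M]
  (F : Type*) [NormedAddCommGroup F] [NormedSpace ℝ F]
  (E : M → Type*) [∀ x, AddCommMonoid (E x)] [∀ x, Module ℝ (E x)]
  [TopologicalSpace (TotalSpace F E)] [∀ x, TopologicalSpace (E x)]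
  [FiberBundle F E] [VectorBundle ℝ F E] [ContMDiffVectorBundle ∞ F E I]

/-! ### The pullback bundles `π^*E` and `π^*TM` -/

/-- The projection `π : E → M` of a smooth vector bundle, as a smooth map. -/
def bundleProj : C^∞⟮I.prod 𝓘(ℝ, F), TotalSpace F E; I, M⟯ :=
  ⟨π F E, contMDiff_proj E⟩

/-- The pullback vector bundle `π^*E → E`; its fibre over `a ∈ E` is `E_{π(a)}`. -/
abbrev PullE : TotalSpace F E → Type _ := (⇑(bundleProj I F E)) *ᵖ E

/-- The pullback vector bundle `π^*TM → E`; its fibre over `a ∈ E` is `T_{π(a)}M`. -/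
abbrev PullTM : TotalSpace F E → Type _ :=
  (⇑(bundleProj I F E)) *ᵖ (TangentSpace I : M → Type _)

/-- The second projection `π^*E → E`, `(a, b) ↦ b`. (The first one is the bundle projection.) -/
def pullSnd : TotalSpace F (PullE I F E) → TotalSpace F E :=
  fun p => ⟨p.proj.proj, p.2⟩

/-- The fibrewise addition `π^*E = E ×_M E → E`, `(a, b) ↦ a + b`. -/
def fibreAdd : TotalSpace F (PullE I F E) → TotalSpace F E :=
  fun p => ⟨p.proj.proj, p.proj.2 + (show E p.proj.proj from p.2)⟩

/-- The fibrewise multiplication by a scalar, `E → E`, `a ↦ c a`. -/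
def fibreSMul (c : ℝ) : TotalSpace F E → TotalSpace F E :=
  fun a => ⟨a.proj, c • a.2⟩

/-! ### The vector bundle structure of `Tπ : TE → TM` -/

/-- `W ∈ T(π^*E)` is identified with the pair `(v, w)` under `T(π^*E) ≃ TE ×_{TM} TE`. -/
def RepresentsPair (W : TangentBundle ((I.prod 𝓘(ℝ, F)).prod 𝓘(ℝ, F)) (TotalSpace F (PullE I F E)))
    (v w : TangentBundle (I.prod 𝓘(ℝ, F)) (TotalSpace F E)) : Prop :=
  tangentMap ((I.prod 𝓘(ℝ, F)).prod 𝓘(ℝ, F)) (I.prod 𝓘(ℝ, F)) (π F (PullE I F E)) W = v ∧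
  tangentMap ((I.prod 𝓘(ℝ, F)).prod 𝓘(ℝ, F)) (I.prod 𝓘(ℝ, F)) (pullSnd I F E) W = w

open Classical in
/-- The addition `v +_τ w` of the vector bundle `Tπ : TE → TM`, for `Tπ v = Tπ w`: the tangent map
of the addition `E ×_M E → E`, applied to the pair `(v, w) ∈ TE ×_{TM} TE ≃ T(E ×_M E)`. (The value
is the irrelevant `v` if `Tπ v ≠ Tπ w`.) -/
def tauAdd (v w : TangentBundle (I.prod 𝓘(ℝ, F)) (TotalSpace F E)) :
    TangentBundle (I.prod 𝓘(ℝ, F)) (TotalSpace F E) :=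
  if h : ∃ W, RepresentsPair I F E W v w then
    tangentMap ((I.prod 𝓘(ℝ, F)).prod 𝓘(ℝ, F)) (I.prod 𝓘(ℝ, F)) (fibreAdd I F E) h.choose
  else v

/-- The scalar multiplication `c ·_τ v` of the vector bundle `Tπ : TE → TM`: the tangent map of
the multiplication by `c` in the fibres of `E`. -/
def tauSMul (c : ℝ) (v : TangentBundle (I.prod 𝓘(ℝ, F)) (TotalSpace F E)) :
    TangentBundle (I.prod 𝓘(ℝ, F)) (TotalSpace F E) :=
  tangentMap (I.prod 𝓘(ℝ, F)) (I.prod 𝓘(ℝ, F)) (fibreSMul F E c) v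

/-- The vertical lift of `Tπ : TE → TM`: for `Tπ v = Tπ w`, the velocity at `s = 0` of
`s ↦ v +_τ s ·_τ w`, an element of `T(TE)`. -/
def verticalLiftT (v w : TangentBundle (I.prod 𝓘(ℝ, F)) (TotalSpace F E)) :
    TangentBundle (I.prod 𝓘(ℝ, F)).tangent
      (TangentBundle (I.prod 𝓘(ℝ, F)) (TotalSpace F E)) :=
  velocity (I.prod 𝓘(ℝ, F)).tangent (fun s : ℝ => tauAdd I F E v (tauSMul I F E s w))

/-- `V ∈ T(TE)` is the vertical lift of `w` at some `v` with `Tπ v = Tπ w`. -/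
def IsVerticalLiftOf
    (V : TangentBundle (I.prod 𝓘(ℝ, F)).tangent
      (TangentBundle (I.prod 𝓘(ℝ, F)) (TotalSpace F E)))
    (w : TangentBundle (I.prod 𝓘(ℝ, F)) (TotalSpace F E)) : Prop :=
  ∃ v, tangentMap (I.prod 𝓘(ℝ, F)) I (π F E) v = tangentMap (I.prod 𝓘(ℝ, F)) I (π F E) w ∧
    verticalLiftT I F E v w = V

open Classical in
/-- The vertical projection `ν_{Tπ} : Ver(Tπ) → TE`, the map with `ν_{Tπ}(ξ^V_{Tπ}(v, w)) = w`.
(The value is the irrelevant base point of `V` if `V` is not a vertical lift.) -/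
def verticalProjT
    (V : TangentBundle (I.prod 𝓘(ℝ, F)).tangent
      (TangentBundle (I.prod 𝓘(ℝ, F)) (TotalSpace F E))) :
    TangentBundle (I.prod 𝓘(ℝ, F)) (TotalSpace F E) :=
  if h : ∃ w, IsVerticalLiftOf I F E V w then h.choose else V.proj

/-! ### Connections with a domain -/

variable {F E}

/-- `ξ` is the horizontal lift of a (nonlinear) connection on the vector bundle `π : E → M`, with
domain `D ⊆ E`: over `D` it is a smooth splitting, linear on the fibres of `π^*TM`, of
`TE → π^*TM`. The values of `ξ` outside `D` are irrelevant. Smoothness on `D` is smoothness of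
`(a, v) ↦ ξ(a, v)` on the set of all `(a, v) ∈ π^*TM` with `a ∈ D`; when `D` is a submanifold,
this is smoothness on the submanifold of these `(a, v)`. -/
structure IsConnectionOn
    (ξ : ∀ a : TotalSpace F E, TangentSpace I a.proj → TangentSpace (I.prod 𝓘(ℝ, F)) a)
    (D : Set (TotalSpace F E)) : Prop where
  isLinearMap : ∀ a ∈ D, IsLinearMap ℝ (ξ a)
  splits : ∀ a ∈ D, ∀ v : TangentSpace I a.proj,
    mfderiv (I.prod 𝓘(ℝ, F)) I (π F E) a (ξ a v) = v
  smooth : ContMDiffOn ((I.prod 𝓘(ℝ, F)).prod 𝓘(ℝ, EB)) (I.prod 𝓘(ℝ, F)).tangent ∞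
    (fun q : TotalSpace EB (PullTM I F E) =>
      (⟨q.proj, ξ q.proj q.2⟩ : TangentBundle (I.prod 𝓘(ℝ, F)) (TotalSpace F E)))
    {q | q.proj ∈ D}

/-- `ξ` is the horizontal lift of a linear connection on the vector bundle `π : E → M`, with domain
the restriction `π⁻¹(C)` of the bundle to `C ⊆ M`: a connection with this domain which satisfies
`ξ(a + a', v) = ξ(a, v) +_τ ξ(a', v)` and `ξ(c a, v) = c ·_τ ξ(a, v)`. -/
structure IsLinearConnectionOn
    (ξ : ∀ a : TotalSpace F E, TangentSpace I a.proj → TangentSpace (I.prod 𝓘(ℝ, F)) a)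
    (C : Set M) : Prop extends IsConnectionOn I ξ {a | a.proj ∈ C} where
  map_add : ∀ m ∈ C, ∀ (a a' : E m) (v : TangentSpace I m),
    (⟨⟨m, a + a'⟩, ξ ⟨m, a + a'⟩ v⟩ : TangentBundle (I.prod 𝓘(ℝ, F)) (TotalSpace F E)) =
      tauAdd I F E ⟨⟨m, a⟩, ξ ⟨m, a⟩ v⟩ ⟨⟨m, a'⟩, ξ ⟨m, a'⟩ v⟩
  map_smul : ∀ m ∈ C, ∀ (c : ℝ) (a : E m) (v : TangentSpace I m),
    (⟨⟨m, c • a⟩, ξ ⟨m, c • a⟩ v⟩ : TangentBundle (I.prod 𝓘(ℝ, F)) (TotalSpace F E)) =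
      tauSMul I F E c ⟨⟨m, a⟩, ξ ⟨m, a⟩ v⟩

/-! ### The linearization -/

/-- The curve `s ↦ ξ(a + s b, Tπ(w))` in `TE`, for `b ∈ E_{π(a)}` and `w ∈ T_aE`. -/
def linCurve
    (ξ : ∀ a : TotalSpace F E, TangentSpace I a.proj → TangentSpace (I.prod 𝓘(ℝ, F)) a)
    (a : TotalSpace F E) (b : E a.proj) (w : TangentSpace (I.prod 𝓘(ℝ, F)) a) (s : ℝ) :
    TangentBundle (I.prod 𝓘(ℝ, F)) (TotalSpace F E) :=
  ⟨⟨a.proj, a.2 + s • b⟩,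
    ξ ⟨a.proj, a.2 + s • b⟩ (mfderiv (I.prod 𝓘(ℝ, F)) I (π F E) a w)⟩

/-- `B(a, b)w = ν_{Tπ}(d/ds ξ(a + s b, Tπ(w))|_{s=0})`, for `b ∈ E_{π(a)}` and `w ∈ T_aE`. -/
def linB
    (ξ : ∀ a : TotalSpace F E, TangentSpace I a.proj → TangentSpace (I.prod 𝓘(ℝ, F)) a)
    (a : TotalSpace F E) (b : E a.proj) (w : TangentSpace (I.prod 𝓘(ℝ, F)) a) :
    TangentBundle (I.prod 𝓘(ℝ, F)) (TotalSpace F E) :=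
  verticalProjT I F E (velocity (I.prod 𝓘(ℝ, F)).tangent (linCurve I ξ a b w))

open Classical in
/-- The map `((a, b), w) ↦ (w, B(a, b)w)` from `(π^*π)^*(TE)` to `T(π^*E) ≃ TE ×_{TM} TE`.
(The value is the irrelevant `0` if `(w, B(a, b)w)` is not tangent to `π^*E` at `(a, b)`.) -/
def linLift
    (ξ : ∀ a : TotalSpace F E, TangentSpace I a.proj → TangentSpace (I.prod 𝓘(ℝ, F)) a)
    (p : TotalSpace F (PullE I F E)) (w : TangentSpace (I.prod 𝓘(ℝ, F)) p.proj) :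
    TangentSpace ((I.prod 𝓘(ℝ, F)).prod 𝓘(ℝ, F)) p :=
  if h : ∃ W : TangentSpace ((I.prod 𝓘(ℝ, F)).prod 𝓘(ℝ, F)) p,
      RepresentsPair I F E ⟨p, W⟩ ⟨p.proj, w⟩ (linB I ξ p.proj p.2 w) then h.choose
  else 0

end VectorBundleConnections

end

noncomputable section

/-! The preferred chart of `E` at a point of `E_m` depends on `m` only: it is a chart of `M` at `m`
together with the trivialization of `E` at `m`. Hence all tangent vectors at points of one fibre are
pairs `(v, α)` in `EB × F` with respect to a single chart, written `tangentMk I a v α`. In these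
coordinates the operations of `Tπ` are `(a, v, α) +_τ (b, v, β) = (a + b, v, α + β)` and `c ·_τ (a,
v, α) = (c a, v, c α)`, and the vertical lift of `(b, v, β)` at `(a, v, α)` has components `(0, b̂)`
and `(0, β)`, where `b̂` is the coordinate of `b` in `F`.

The curve defining `B(a, b)w` stays in the fibre of `a`. With `v = Tπ(w)` and `ξ(a, v) = (v, Γ(a,
v))` it reads `s ↦ (a + s b, v, Γ(a + s b, v))`. Since `C` is open in the fibre, this makes sense
for small `s`, and its velocity is the vertical lift of `(b, v, D_aΓ(a, v) b̂)` and of nothing else.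
So `B(a, b)w = (b, v, D_aΓ(a, v) b̂)` (`linB_eq`). It is linear in `b` because a Fréchet derivative
is linear, and linear in `w` because `Γ(a, v)` is linear in `v` for each `a` in `C`.

Smoothness needs a varying base point, and `C` need not be open in `E`. Locally there is a smooth
retraction `ρ` onto the submanifold `C`. The vertical component of `ξ(ρ(a + s b), v)`, in a fixed
trivialization and with `v` of prescribed coordinates, is smooth in all variables near `s = 0`, and
so is its `s`-derivative. For `a` in `C` and small `s` the point `a + s b` is in `C` and fixed by
`ρ`, so this derivative is the vertical component of `B(a, b)w` (`exists_contMDiffAt_eq_trivVert`).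
The passage from the chart at `m` to the fixed trivialization at `m₀` is `hasDerivAt_trivVert`. -/

/-- A map which is a continuous linear map in the preferred charts has this linear map as its
derivative. -/
lemma hasMFDerivAt_of_extChartAt_comp
    {EN HN N : Type*} [NormedAddCommGroup EN] [NormedSpace ℝ EN]
    [TopologicalSpace HN] {J : ModelWithCorners ℝ EN HN} [TopologicalSpace N] [ChartedSpace HN N]
    {EN' HN' N' : Type*} [NormedAddCommGroup EN'] [NormedSpace ℝ EN']
    [TopologicalSpace HN'] {J' : ModelWithCorners ℝ EN' HN'} [TopologicalSpace N']
    [ChartedSpace HN' N'] {f : N → N'} {x : N} (hf : ContinuousAt f x) (L : EN →L[ℝ] EN')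
    (h : ∀ᶠ y in 𝓝 x, extChartAt J' (f x) (f y) = L (extChartAt J x y)) :
    HasMFDerivAt J J' f x L := by
  refine ⟨hf, ?_⟩
  have hev : ∀ᶠ z in 𝓝[range J] (extChartAt J x x),
      writtenInExtChartAt J J' x f z = L z := by
    have h1 : Filter.Tendsto (extChartAt J x).symm (𝓝[range J] (extChartAt J x x)) (𝓝 x) := by
      have := (continuousAt_extChartAt_symm (I := J) x).tendsto
      rw [extChartAt_to_inv] at this
      exact this.mono_left nhdsWithin_le_nhds
    filter_upwards [h1.eventually h, extChartAt_target_mem_nhdsWithin (I := J) x] with z hz hz'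
    simp only [writtenInExtChartAt, Function.comp_apply]
    rw [hz, (extChartAt J x).right_inv hz']
  refine L.hasFDerivWithinAt.congr_of_eventuallyEq hev ?_
  exact hev.self_of_nhdsWithin (mem_range_self _)

set_option linter.unusedSectionVars false

/-! ### Derivatives of the structure maps of `E` in adapted charts -/

section VectorBundle

variable {EB : Type*} [NormedAddCommGroup EB] [NormedSpace ℝ EB]
  {HB : Type*} [TopologicalSpace HB] {I : ModelWithCorners ℝ EB HB}
  {M : Type*} [TopologicalSpace M] [ChartedSpace HB M] [IsManifold I ∞ M]
  {F : Type*} [NormedAddCommGroup F] [NormedSpace ℝ F]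
  {E : M → Type*} [∀ x, AddCommMonoid (E x)] [∀ x, Module ℝ (E x)]
  [TopologicalSpace (TotalSpace F E)] [∀ x, TopologicalSpace (E x)]
  [FiberBundle F E] [VectorBundle ℝ F E] [ContMDiffVectorBundle ∞ F E I]

/-- The preferred charts of the total space of a bundle depend on the base point only. -/
lemma extChartAt_totalSpace_apply {m : M} (c : E m) {a : TotalSpace F E}
    (ha : a.proj ∈ (trivializationAt F E m).baseSet) :
    extChartAt (I.prod 𝓘(ℝ, F)) (⟨m, c⟩ : TotalSpace F E) a =
      (extChartAt I m a.proj, (trivializationAt F E m a).2) := by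
  rw [FiberBundle.extChartAt]
  simp only [PartialEquiv.coe_trans, Function.comp_apply, PartialEquiv.prod_coe,
    PartialEquiv.refl_coe, id]
  rw [OpenPartialHomeomorph.coe_toPartialEquiv, Trivialization.coe_coe,
    Trivialization.coe_fst' _ ha]

lemma eventually_mem_baseSet_of_mem {m : M} {a : TotalSpace F E}
    (ha : a.proj ∈ (trivializationAt F E m).baseSet) :
    ∀ᶠ y in 𝓝 a, y.proj ∈ (trivializationAt F E m).baseSet :=
  (FiberBundle.continuous_proj F E).continuousAt.eventually
    ((trivializationAt F E m).open_baseSet.mem_nhds ha)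

lemma eventually_proj_mem_baseSet (a : TotalSpace F E) :
    ∀ᶠ y in 𝓝 a, y.proj ∈ (trivializationAt F E a.proj).baseSet :=
  eventually_mem_baseSet_of_mem (mem_baseSet_trivializationAt F E a.proj)

variable (I) in
lemma hasMFDerivAt_proj (a : TotalSpace F E) :
    HasMFDerivAt (I.prod 𝓘(ℝ, F)) I (π F E) a (ContinuousLinearMap.fst ℝ EB F) := by
  refine hasMFDerivAt_of_extChartAt_comp (FiberBundle.continuous_proj F E).continuousAt _ ?_
  filter_upwards [eventually_proj_mem_baseSet a] with y hy
  rw [extChartAt_totalSpace_apply a.2 hy]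
  rfl

lemma contMDiff_pullSnd : ContMDiff ((I.prod 𝓘(ℝ, F)).prod 𝓘(ℝ, F)) (I.prod 𝓘(ℝ, F)) ∞
    (pullSnd I F E) := by
  intro p
  have h := contMDiffAt_totalSpace.1 (contMDiffAt_id (I := (I.prod 𝓘(ℝ, F)).prod 𝓘(ℝ, F))
    (n := ∞) (x := p))
  have h1 : ContMDiffAt ((I.prod 𝓘(ℝ, F)).prod 𝓘(ℝ, F)) I ∞
      (fun y : TotalSpace F (PullE I F E) => (π F E) y.proj) p :=
    (contMDiffAt_proj E).comp p h.1
  exact contMDiffAt_totalSpace.2 ⟨h1, h.2⟩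

lemma hasMFDerivAt_pullSnd (p : TotalSpace F (PullE I F E)) :
    HasMFDerivAt ((I.prod 𝓘(ℝ, F)).prod 𝓘(ℝ, F)) (I.prod 𝓘(ℝ, F)) (pullSnd I F E) p
      (((ContinuousLinearMap.fst ℝ EB F).comp (ContinuousLinearMap.fst ℝ (EB × F) F)).prod
        (ContinuousLinearMap.snd ℝ (EB × F) F)) := by
  refine hasMFDerivAt_of_extChartAt_comp contMDiff_pullSnd.continuous.continuousAt _ ?_
  filter_upwards [eventually_proj_mem_baseSet p] with y hy
  have hy' : (pullSnd I F E y).proj ∈ (trivializationAt F E p.proj.proj).baseSet := hy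
  rw [extChartAt_totalSpace_apply p.2 hy]
  rw [extChartAt_totalSpace_apply (a := y.proj) p.proj.2 hy']
  refine (extChartAt_totalSpace_apply (a := pullSnd I F E y) (pullSnd I F E p).2 hy').trans ?_
  exact Prod.ext rfl rfl

/-- The fibrewise addition in a trivialization. -/
lemma trivialization_fibreAdd_snd {m : M} {y : TotalSpace F (PullE I F E)}
    (hy : y.proj.proj ∈ (trivializationAt F E m).baseSet) :
    (trivializationAt F E m (fibreAdd I F E y)).2 =
      (trivializationAt F E m y.proj).2 + (trivializationAt F E m (pullSnd I F E y)).2 :=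
  ((trivializationAt F E m).linear ℝ hy).map_add y.proj.2 y.2

lemma trivialization_fibreSMul_snd (c : ℝ) {m : M} {y : TotalSpace F E}
    (hy : y.proj ∈ (trivializationAt F E m).baseSet) :
    (trivializationAt F E m (fibreSMul F E c y)).2 = c • (trivializationAt F E m y).2 :=
  ((trivializationAt F E m).linear ℝ hy).map_smul c y.2

lemma contMDiffAt_trivialization_snd {m : M} {a : TotalSpace F E}
    (ha : a.proj ∈ (trivializationAt F E m).baseSet) :
    ContMDiffAt (I.prod 𝓘(ℝ, F)) 𝓘(ℝ, F) ∞ (fun y => (trivializationAt F E m y).2) a :=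
  (((trivializationAt F E m).contMDiffAt_iff (f := id) (IM := I.prod 𝓘(ℝ, F)) (IB := I)
    ((trivializationAt F E m).mem_source.2 ha)).1 contMDiffAt_id).2

lemma contMDiff_fibreAdd : ContMDiff ((I.prod 𝓘(ℝ, F)).prod 𝓘(ℝ, F)) (I.prod 𝓘(ℝ, F)) ∞
    (fibreAdd I F E) := by
  intro p
  refine contMDiffAt_totalSpace.2 ⟨?_, ?_⟩
  · have h1 : ContMDiffAt ((I.prod 𝓘(ℝ, F)).prod 𝓘(ℝ, F)) I ∞
        (fun y : TotalSpace F (PullE I F E) => (π F E) y.proj) p :=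
      (contMDiffAt_proj E).comp p (contMDiffAt_proj (PullE I F E))
    exact h1
  · have hp : p.proj.proj ∈ (trivializationAt F E p.proj.proj).baseSet :=
      mem_baseSet_trivializationAt F E p.proj.proj
    have h1 : ContMDiffAt ((I.prod 𝓘(ℝ, F)).prod 𝓘(ℝ, F)) 𝓘(ℝ, F) ∞
        (fun y : TotalSpace F (PullE I F E) => (trivializationAt F E p.proj.proj y.proj).2) p :=
      (contMDiffAt_trivialization_snd (I := I) (a := p.proj) hp).comp p
        (contMDiff_proj (PullE I F E)).contMDiffAt
    have h2 : ContMDiffAt ((I.prod 𝓘(ℝ, F)).prod 𝓘(ℝ, F)) 𝓘(ℝ, F) ∞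
        (fun y : TotalSpace F (PullE I F E) =>
          (trivializationAt F E p.proj.proj (pullSnd I F E y)).2) p :=
      (contMDiffAt_trivialization_snd (I := I) (a := pullSnd I F E p) hp).comp p
        contMDiff_pullSnd.contMDiffAt
    refine (h1.add h2).congr_of_eventuallyEq ?_
    filter_upwards [eventually_proj_mem_baseSet p] with y hy
    exact trivialization_fibreAdd_snd hy

lemma hasMFDerivAt_fibreAdd (p : TotalSpace F (PullE I F E)) :
    HasMFDerivAt ((I.prod 𝓘(ℝ, F)).prod 𝓘(ℝ, F)) (I.prod 𝓘(ℝ, F)) (fibreAdd I F E) p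
      (((ContinuousLinearMap.fst ℝ EB F).comp (ContinuousLinearMap.fst ℝ (EB × F) F)).prod
        ((ContinuousLinearMap.snd ℝ EB F).comp (ContinuousLinearMap.fst ℝ (EB × F) F) +
          ContinuousLinearMap.snd ℝ (EB × F) F)) := by
  refine hasMFDerivAt_of_extChartAt_comp contMDiff_fibreAdd.continuous.continuousAt _ ?_
  filter_upwards [eventually_proj_mem_baseSet p] with y hy
  have hy' : (fibreAdd I F E y).proj ∈ (trivializationAt F E p.proj.proj).baseSet := hy
  rw [extChartAt_totalSpace_apply p.2 hy]
  rw [extChartAt_totalSpace_apply (a := y.proj) p.proj.2 hy']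
  refine (extChartAt_totalSpace_apply (a := fibreAdd I F E y) (fibreAdd I F E p).2 hy').trans ?_
  exact Prod.ext rfl (trivialization_fibreAdd_snd hy')

lemma contMDiff_fibreSMul (c : ℝ) : ContMDiff (I.prod 𝓘(ℝ, F)) (I.prod 𝓘(ℝ, F)) ∞
    (fibreSMul F E c) := by
  intro a
  refine contMDiffAt_totalSpace.2 ⟨(contMDiff_proj E).contMDiffAt, ?_⟩
  refine ((contDiff_const_smul c).contMDiff.contMDiffAt.comp a
    (contMDiffAt_trivialization_snd (I := I)
      (mem_baseSet_trivializationAt F E a.proj))).congr_of_eventuallyEq ?_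
  filter_upwards [eventually_proj_mem_baseSet a] with y hy
  exact trivialization_fibreSMul_snd c hy

lemma hasMFDerivAt_fibreSMul (c : ℝ) (a : TotalSpace F E) :
    HasMFDerivAt (I.prod 𝓘(ℝ, F)) (I.prod 𝓘(ℝ, F)) (fibreSMul F E c) a
      ((ContinuousLinearMap.fst ℝ EB F).prod (c • ContinuousLinearMap.snd ℝ EB F)) := by
  refine hasMFDerivAt_of_extChartAt_comp
    (contMDiff_fibreSMul (I := I) c).continuous.continuousAt _ ?_
  filter_upwards [eventually_proj_mem_baseSet a] with y hy
  rw [extChartAt_totalSpace_apply a.2 hy]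
  refine (extChartAt_totalSpace_apply (a := fibreSMul F E c y) (fibreSMul F E c a).2 hy).trans ?_
  exact Prod.ext rfl (trivialization_fibreSMul_snd c hy)

/-! ### Velocities of curves read in a chart -/

lemma hasMFDerivAt_of_hasDerivAt_extChartAt
    {EN HN N : Type*} [NormedAddCommGroup EN] [NormedSpace ℝ EN]
    [TopologicalSpace HN] {J : ModelWithCorners ℝ EN HN} [TopologicalSpace N] [ChartedSpace HN N]
    {c : ℝ → N} {s₀ : ℝ} {d : EN} (hs : ∀ᶠ s in 𝓝 s₀, c s ∈ (extChartAt J (c s₀)).source)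
    (hd : HasDerivAt (fun s => extChartAt J (c s₀) (c s)) d s₀) :
    HasMFDerivAt 𝓘(ℝ, ℝ) J c s₀ (ContinuousLinearMap.toSpanSingleton ℝ d) := by
  refine ⟨?_, ?_⟩
  -- The curve stays in the chart domain, so its continuity is recovered from that of its
  -- coordinates.
  · have h1 : ContinuousAt (fun s => (extChartAt J (c s₀)).symm (extChartAt J (c s₀) (c s))) s₀ :=
      ContinuousAt.comp (g := (extChartAt J (c s₀)).symm)
        (continuousAt_extChartAt_symm (I := J) (c s₀)) hd.continuousAt
    refine h1.congr ?_
    filter_upwards [hs] with s h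
    exact (extChartAt J (c s₀)).left_inv h
  · have := hd.hasFDerivAt.hasFDerivWithinAt (s := range 𝓘(ℝ, ℝ))
    exact this

lemma velocity_eq_of_hasDerivAt_extChartAt
    {EN HN N : Type*} [NormedAddCommGroup EN] [NormedSpace ℝ EN]
    [TopologicalSpace HN] {J : ModelWithCorners ℝ EN HN} [TopologicalSpace N] [ChartedSpace HN N]
    {c : ℝ → N} {d : EN} (hs : ∀ᶠ s in 𝓝 (0 : ℝ), c s ∈ (extChartAt J (c 0)).source)
    (hd : HasDerivAt (fun s => extChartAt J (c 0) (c s)) d 0) :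
    velocity J c = ⟨c 0, (show TangentSpace J (c 0) from d)⟩ := by
  have h := hasMFDerivAt_of_hasDerivAt_extChartAt hs hd
  unfold velocity tangentMap
  rw [h.mfderiv]
  refine congrArg (TotalSpace.mk (c 0)) ?_
  exact (ContinuousLinearMap.toSpanSingleton_apply ℝ d (1 : ℝ)).trans (one_smul ℝ d)

/-! ### Tangent vectors to `E` in coordinates and the operations of `Tπ` -/

variable (I) in
/-- The tangent vector at `a ∈ E` with components `v` and `α` in the preferred chart at `a`. -/
def tangentMk (a : TotalSpace F E) (v : EB) (α : F) :
    TangentBundle (I.prod 𝓘(ℝ, F)) (TotalSpace F E) :=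
  ⟨a, (show TangentSpace (I.prod 𝓘(ℝ, F)) a from (v, α))⟩

lemma tangentMk_inj {a a' : TotalSpace F E} {v v' : EB} {α α' : F} :
    tangentMk I a v α = tangentMk I a' v' α' ↔ a = a' ∧ v = v' ∧ α = α' := by
  constructor
  · intro h
    obtain rfl : a = a' := congrArg TotalSpace.proj h
    have h2 : (v, α) = (v', α') := (TotalSpace.mk_inj (F := EB × F)
      (E := (TangentSpace (I.prod 𝓘(ℝ, F)) : TotalSpace F E → Type _))).1 h
    exact ⟨rfl, (Prod.mk.inj h2).1, (Prod.mk.inj h2).2⟩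
  · rintro ⟨rfl, rfl, rfl⟩
    rfl

lemma exists_eq_tangentMk (V : TangentBundle (I.prod 𝓘(ℝ, F)) (TotalSpace F E)) :
    ∃ v α, V = tangentMk I V.proj v α :=
  ⟨(show EB × F from V.2).1, (show EB × F from V.2).2, rfl⟩

lemma tangentMap_proj_tangentMk (a : TotalSpace F E) (v : EB) (α : F) :
    tangentMap (I.prod 𝓘(ℝ, F)) I (π F E) (tangentMk I a v α) =
      ⟨a.proj, (show TangentSpace I a.proj from v)⟩ := by
  refine congrArg (TotalSpace.mk a.proj) ?_
  exact congrArg (fun L : EB × F →L[ℝ] EB => L (v, α)) (hasMFDerivAt_proj I a).mfderiv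

lemma tangentMap_pullSnd_tangentMk (p : TotalSpace F (PullE I F E)) (v : EB) (α β : F) :
    tangentMap ((I.prod 𝓘(ℝ, F)).prod 𝓘(ℝ, F)) (I.prod 𝓘(ℝ, F)) (pullSnd I F E)
      (tangentMk (I.prod 𝓘(ℝ, F)) p (v, α) β) = tangentMk I (pullSnd I F E p) v β := by
  refine congrArg (TotalSpace.mk (pullSnd I F E p)) ?_
  exact congrArg (fun L : (EB × F) × F →L[ℝ] EB × F => L ((v, α), β))
    (hasMFDerivAt_pullSnd p).mfderiv

lemma tangentMap_fibreAdd_tangentMk (p : TotalSpace F (PullE I F E)) (v : EB) (α β : F) :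
    tangentMap ((I.prod 𝓘(ℝ, F)).prod 𝓘(ℝ, F)) (I.prod 𝓘(ℝ, F)) (fibreAdd I F E)
      (tangentMk (I.prod 𝓘(ℝ, F)) p (v, α) β) = tangentMk I (fibreAdd I F E p) v (α + β) := by
  refine congrArg (TotalSpace.mk (fibreAdd I F E p)) ?_
  exact congrArg (fun L : (EB × F) × F →L[ℝ] EB × F => L ((v, α), β))
    (hasMFDerivAt_fibreAdd p).mfderiv

lemma tauSMul_tangentMk (c : ℝ) (a : TotalSpace F E) (v : EB) (α : F) :
    tauSMul I F E c (tangentMk I a v α) = tangentMk I (fibreSMul F E c a) v (c • α) := by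
  refine congrArg (TotalSpace.mk (fibreSMul F E c a)) ?_
  exact congrArg (fun L : EB × F →L[ℝ] EB × F => L (v, α)) (hasMFDerivAt_fibreSMul c a).mfderiv

/-- Tangent vectors to `π^*E` at `(a, b)` have components `((v, α), β)`, and the two projections
read off `(v, α)` and `(v, β)`. This is the identification of `T(π^*E)` with `TE ×_{TM} TE`, and it
makes the choices in `tauAdd` and `linLift` unambiguous. -/
lemma representsPair_tangentMk_iff
    {W : TangentBundle ((I.prod 𝓘(ℝ, F)).prod 𝓘(ℝ, F)) (TotalSpace F (PullE I F E))}
    {m : M} {a b : E m} {v v' : EB} {α β : F} :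
    RepresentsPair I F E W (tangentMk I ⟨m, a⟩ v α) (tangentMk I ⟨m, b⟩ v' β) ↔
      v = v' ∧ W = tangentMk (I.prod 𝓘(ℝ, F))
        (⟨⟨m, a⟩, b⟩ : TotalSpace F (PullE I F E)) (v, α) β := by
  constructor
  · rintro ⟨h1, h2⟩
    obtain ⟨⟨v₀, α₀⟩, β₀, hW⟩ := exists_eq_tangentMk W
    rw [hW] at h1 h2 ⊢
    rw [tangentMap_pullSnd_tangentMk, tangentMk_inj] at h2
    have h1' : tangentMk I W.proj.proj v₀ α₀ = tangentMk I ⟨m, a⟩ v α :=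
      (tangentMap_proj_tangentMk (I := I.prod 𝓘(ℝ, F)) W.proj (v₀, α₀) β₀).symm.trans h1
    rw [tangentMk_inj] at h1'
    obtain ⟨ha, rfl, rfl⟩ := h1'
    obtain ⟨hb, rfl, rfl⟩ := h2
    refine ⟨rfl, ?_⟩
    have hp : W.proj = (⟨⟨m, a⟩, b⟩ : TotalSpace F (PullE I F E)) := by
      generalize W.proj = p at ha hb
      obtain ⟨q, b'⟩ := p
      obtain rfl : q = ⟨m, a⟩ := ha
      have : b' = b := (TotalSpace.mk_inj (F := F) (E := E)).1 hb
      rw [this]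
    rw [hp]
  · rintro ⟨rfl, rfl⟩
    exact ⟨tangentMap_proj_tangentMk (I := I.prod 𝓘(ℝ, F)) _ (v, α) β,
      tangentMap_pullSnd_tangentMk _ v α β⟩

lemma tauAdd_tangentMk {m : M} (a b : E m) (v : EB) (α β : F) :
    tauAdd I F E (tangentMk I ⟨m, a⟩ v α) (tangentMk I ⟨m, b⟩ v β) =
      tangentMk I ⟨m, a + b⟩ v (α + β) := by
  have h : ∃ W, RepresentsPair I F E W (tangentMk I ⟨m, a⟩ v α) (tangentMk I ⟨m, b⟩ v β) :=
    ⟨_, representsPair_tangentMk_iff.2 ⟨rfl, rfl⟩⟩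
  unfold tauAdd
  rw [dif_pos h, (representsPair_tangentMk_iff.1 h.choose_spec).2, tangentMap_fibreAdd_tangentMk]
  rfl

/-! ### Charts of `TE` over a single fibre of `E`, and vertical lifts -/

/-- The trivializations of a tangent bundle are the tangent maps of the charts. -/
lemma trivializationAt_tangentSpace_snd
    {EN HN N : Type*} [NormedAddCommGroup EN] [NormedSpace ℝ EN]
    [TopologicalSpace HN] {J : ModelWithCorners ℝ EN HN} [TopologicalSpace N] [ChartedSpace HN N]
    [IsManifold J 1 N] {x : N} {V : TangentBundle J N} (hV : V.proj ∈ (chartAt HN x).source) :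
    (trivializationAt EN (TangentSpace J) x V).2 =
      (show TangentSpace J V.proj →L[ℝ] EN from mfderiv J 𝓘(ℝ, EN) (extChartAt J x) V.proj) V.2 := by
  rw [← TangentBundle.continuousLinearMapAt_trivializationAt hV]
  exact (congrFun (Trivialization.coe_linearMapAt_of_mem (R := ℝ)
    (trivializationAt EN (TangentSpace J) x) hV) V.2).symm

lemma chartAt_totalSpace_eq (m : M) (a c : E m) :
    chartAt (ModelProd HB F) (⟨m, a⟩ : TotalSpace F E) =
      chartAt (ModelProd HB F) (⟨m, c⟩ : TotalSpace F E) := by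
  rw [FiberBundle.chartedSpace_chartAt, FiberBundle.chartedSpace_chartAt]

/-- Points of the same fibre have the same preferred chart, so no coordinate change occurs between
them. This is what makes curves over one fibre computable by ordinary derivatives. -/
lemma trivializationAt_tangentSpace_tangentMk (m : M) (a c : E m) (v : EB) (α : F) :
    (trivializationAt (EB × F) (TangentSpace (I.prod 𝓘(ℝ, F))) (⟨m, a⟩ : TotalSpace F E)
      (tangentMk I ⟨m, c⟩ v α)).2 = (v, α) := by
  have h : trivializationAt (EB × F) (TangentSpace (I.prod 𝓘(ℝ, F))) (⟨m, a⟩ : TotalSpace F E) =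
      trivializationAt (EB × F) (TangentSpace (I.prod 𝓘(ℝ, F))) (⟨m, c⟩ : TotalSpace F E) := by
    rw [TangentBundle.trivializationAt_eq_localTriv, TangentBundle.trivializationAt_eq_localTriv]
    congr 1
    exact Subtype.ext (chartAt_totalSpace_eq m a c)
  rw [h]
  refine (trivializationAt_tangentSpace_snd (x := (⟨m, c⟩ : TotalSpace F E))
    (V := tangentMk I ⟨m, c⟩ v α) (mem_chart_source (ModelProd HB F) (⟨m, c⟩ : TotalSpace F E))).trans ?_
  exact congrArg (fun L : EB × F →L[ℝ] EB × F => L (v, α)) mfderiv_extChartAt_self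

lemma mk_mem_chartAt_source (m : M) (a c : E m) :
    (⟨m, c⟩ : TotalSpace F E) ∈
      (chartAt (ModelProd HB F) (⟨m, a⟩ : TotalSpace F E)).source := by
  rw [chartAt_totalSpace_eq m a c]
  exact mem_chart_source (ModelProd HB F) (⟨m, c⟩ : TotalSpace F E)

lemma extChartAt_tangentMk {m : M} (a c : E m) (v v' : EB) (α α' : F) :
    extChartAt (I.prod 𝓘(ℝ, F)).tangent (tangentMk I ⟨m, a⟩ v α) (tangentMk I ⟨m, c⟩ v' α') =
      ((extChartAt I m m, (trivializationAt F E m ⟨m, c⟩).2), (v', α')) := by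
  refine (extChartAt_totalSpace_apply (I := I.prod 𝓘(ℝ, F)) (a := tangentMk I ⟨m, c⟩ v' α')
    (m := (⟨m, a⟩ : TotalSpace F E)) _ (mk_mem_chartAt_source m a c)).trans ?_
  refine Prod.ext ?_ ?_
  · exact extChartAt_totalSpace_apply (a := (⟨m, c⟩ : TotalSpace F E)) a
      (mem_baseSet_trivializationAt F E m)
  · exact trivializationAt_tangentSpace_tangentMk m a c v' α'

lemma tangentMk_mem_extChartAt_source {m : M} (a c : E m) (v v' : EB) (α α' : F) :
    tangentMk I ⟨m, c⟩ v' α' ∈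
      (extChartAt (I.prod 𝓘(ℝ, F)).tangent (tangentMk I ⟨m, a⟩ v α)).source := by
  rw [extChartAt_source]
  exact (TangentBundle.mem_chart_source_iff _ _).2 (mk_mem_chartAt_source m a c)

section Curves

variable {m : M} {a : ℝ → E m} {v : EB} {α : ℝ → F} {a' α' : F}

lemma hasDerivAt_extChartAt_tangentMk
    (ha : HasDerivAt (fun s => (trivializationAt F E m ⟨m, a s⟩).2) a' 0)
    (hα : HasDerivAt α α' 0) :
    HasDerivAt (fun s => extChartAt (I.prod 𝓘(ℝ, F)).tangent (tangentMk I ⟨m, a 0⟩ v (α 0))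
      (tangentMk I ⟨m, a s⟩ v (α s))) (((0, a'), (0, α')) : (EB × F) × (EB × F)) 0 := by
  have h : HasDerivAt (fun s => ((extChartAt I m m, (trivializationAt F E m ⟨m, a s⟩).2),
      (v, α s))) (((0, a'), (0, α')) : (EB × F) × (EB × F)) 0 :=
    ((hasDerivAt_const _ _).prodMk ha).prodMk ((hasDerivAt_const _ _).prodMk hα)
  exact h.congr_of_eventuallyEq (.of_forall fun s => extChartAt_tangentMk _ _ _ _ _ _)

lemma mdifferentiableAt_tangentMk
    (ha : HasDerivAt (fun s => (trivializationAt F E m ⟨m, a s⟩).2) a' 0)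
    (hα : HasDerivAt α α' 0) :
    MDifferentiableAt 𝓘(ℝ, ℝ) (I.prod 𝓘(ℝ, F)).tangent
      (fun s => tangentMk I ⟨m, a s⟩ v (α s)) 0 :=
  (hasMFDerivAt_of_hasDerivAt_extChartAt (J := (I.prod 𝓘(ℝ, F)).tangent)
    (c := fun s => tangentMk I ⟨m, a s⟩ v (α s)) (s₀ := 0) (d := ((0, a'), (0, α')))
    (.of_forall fun _ => tangentMk_mem_extChartAt_source _ _ _ _ _ _)
    (hasDerivAt_extChartAt_tangentMk ha hα)).mdifferentiableAt

lemma velocity_tangentMk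
    (ha : HasDerivAt (fun s => (trivializationAt F E m ⟨m, a s⟩).2) a' 0)
    (hα : HasDerivAt α α' 0) :
    velocity (I.prod 𝓘(ℝ, F)).tangent (fun s => tangentMk I ⟨m, a s⟩ v (α s)) =
      tangentMk (I.prod 𝓘(ℝ, F)) (tangentMk I ⟨m, a 0⟩ v (α 0)) (0, a') (0, α') :=
  velocity_eq_of_hasDerivAt_extChartAt (J := (I.prod 𝓘(ℝ, F)).tangent)
    (c := fun s => tangentMk I ⟨m, a s⟩ v (α s)) (d := ((0, a'), (0, α')))
    (.of_forall fun _ => tangentMk_mem_extChartAt_source _ _ _ _ _ _)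
    (hasDerivAt_extChartAt_tangentMk ha hα)

end Curves

lemma trivialization_add_smul_snd (m : M) (a b : E m) (s : ℝ) :
    (trivializationAt F E m ⟨m, a + s • b⟩).2 =
      (trivializationAt F E m ⟨m, a⟩).2 + s • (trivializationAt F E m ⟨m, b⟩).2 := by
  have h := (trivializationAt F E m).linear ℝ (mem_baseSet_trivializationAt F E m)
  exact (h.map_add _ _).trans (congrArg _ (h.map_smul _ _))

lemma hasDerivAt_trivialization_add_smul (m : M) (a b : E m) (s₀ : ℝ) :
    HasDerivAt (fun s : ℝ => (trivializationAt F E m ⟨m, a + s • b⟩).2)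
      (trivializationAt F E m ⟨m, b⟩).2 s₀ := by
  simp only [trivialization_add_smul_snd]
  simpa using ((hasDerivAt_id s₀).smul_const (trivializationAt F E m ⟨m, b⟩).2).const_add
    (trivializationAt F E m ⟨m, a⟩).2

lemma tauAdd_tauSMul_tangentMk {m : M} (a b : E m) (v : EB) (α β : F) (s : ℝ) :
    tauAdd I F E (tangentMk I ⟨m, a⟩ v α) (tauSMul I F E s (tangentMk I ⟨m, b⟩ v β)) =
      tangentMk I ⟨m, a + s • b⟩ v (α + s • β) := by
  rw [tauSMul_tangentMk]
  exact tauAdd_tangentMk a (s • b) v α (s • β)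

lemma hasDerivAt_add_smul (α β : F) (s₀ : ℝ) : HasDerivAt (fun s : ℝ => α + s • β) β s₀ := by
  simpa using ((hasDerivAt_id s₀).smul_const β).const_add α

lemma verticalLiftT_tangentMk {m : M} (a b : E m) (v : EB) (α β : F) :
    verticalLiftT I F E (tangentMk I ⟨m, a⟩ v α) (tangentMk I ⟨m, b⟩ v β) =
      tangentMk (I.prod 𝓘(ℝ, F)) (tangentMk I ⟨m, a⟩ v α)
        (0, (trivializationAt F E m ⟨m, b⟩).2) (0, β) := by
  unfold verticalLiftT
  simp only [tauAdd_tauSMul_tangentMk]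
  rw [velocity_tangentMk (a := fun s : ℝ => a + s • b) (α := fun s : ℝ => α + s • β)
    (hasDerivAt_trivialization_add_smul m a b 0) (hasDerivAt_add_smul α β 0)]
  simp only [zero_smul, add_zero]

/-- The coordinates of a vertical lift retain `m`, `v`, `β` and the fibre coordinate of `b`, so the
lifted vector can be recovered. This is the well-definedness of `ν_{Tπ}`. -/
lemma isVerticalLiftOf_tangentMk_iff {m : M} {a b : E m} {v : EB} {α β : F}
    {u : TangentBundle (I.prod 𝓘(ℝ, F)) (TotalSpace F E)} :
    IsVerticalLiftOf I F E (tangentMk (I.prod 𝓘(ℝ, F)) (tangentMk I ⟨m, a⟩ v α)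
        (0, (trivializationAt F E m ⟨m, b⟩).2) (0, β)) u ↔
      u = tangentMk I ⟨m, b⟩ v β := by
  constructor
  · rintro ⟨V, h1, h2⟩
    obtain ⟨v', β', hu⟩ := exists_eq_tangentMk u
    generalize u.proj = b' at hu
    obtain ⟨m', b'⟩ := b'
    subst hu
    obtain ⟨v'', α', hV⟩ := exists_eq_tangentMk V
    generalize V.proj = a' at hV
    obtain ⟨m'', a'⟩ := a'
    subst hV
    rw [tangentMap_proj_tangentMk, tangentMap_proj_tangentMk] at h1
    obtain rfl : m'' = m' := congrArg TotalSpace.proj h1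
    obtain rfl : v'' = v' := (TotalSpace.mk_inj (F := EB)
      (E := (TangentSpace I : M → Type _))).1 h1
    rw [verticalLiftT_tangentMk, tangentMk_inj, tangentMk_inj] at h2
    obtain ⟨⟨ha, rfl, rfl⟩, hb, hβ⟩ := h2
    obtain rfl : m'' = m := congrArg TotalSpace.proj ha
    have hb' : (trivializationAt F E m'' ⟨m'', b'⟩).2 =
        (trivializationAt F E m'' ⟨m'', b⟩).2 :=
      (Prod.mk.inj hb).2
    -- The trivialization is injective on the fibre over `m''`.
    have hbb : b' = b := by
      refine ((trivializationAt F E m'').continuousLinearEquivAt ℝ m''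
        (mem_baseSet_trivializationAt F E m'')).injective ?_
      exact hb'
    rw [hbb, (Prod.mk.inj hβ).2]
  · rintro rfl
    refine ⟨tangentMk I ⟨m, a⟩ v α, ?_, verticalLiftT_tangentMk a b v α β⟩
    rw [tangentMap_proj_tangentMk, tangentMap_proj_tangentMk]

lemma verticalProjT_tangentMk {m : M} (a b : E m) (v : EB) (α β : F) :
    verticalProjT I F E (tangentMk (I.prod 𝓘(ℝ, F)) (tangentMk I ⟨m, a⟩ v α)
        (0, (trivializationAt F E m ⟨m, b⟩).2) (0, β)) = tangentMk I ⟨m, b⟩ v β := by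
  have h : ∃ u, IsVerticalLiftOf I F E (tangentMk (I.prod 𝓘(ℝ, F)) (tangentMk I ⟨m, a⟩ v α)
        (0, (trivializationAt F E m ⟨m, b⟩).2) (0, β)) u :=
    ⟨_, isVerticalLiftOf_tangentMk_iff.2 rfl⟩
  unfold verticalProjT
  rw [dif_pos h]
  exact isVerticalLiftOf_tangentMk_iff.1 h.choose_spec

lemma velocity_congr
    {EN HN N : Type*} [NormedAddCommGroup EN] [NormedSpace ℝ EN]
    [TopologicalSpace HN] {J : ModelWithCorners ℝ EN HN} [TopologicalSpace N] [ChartedSpace HN N]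
    {c c' : ℝ → N} (h : c =ᶠ[𝓝 0] c') : velocity J c = velocity J c' := by
  -- The two velocities lie in tangent spaces at points that are only provably equal; both spaces
  -- are the model space `EN`, which allows the transport.
  have key : ∀ {x y : N} (_ : x = y) (u : EN), (⟨x, (show TangentSpace J x from u)⟩ :
      TangentBundle J N) = ⟨y, (show TangentSpace J y from u)⟩ := by
    rintro x _ rfl u
    rfl
  refine (key h.eq_of_nhds _).trans (congrArg (TotalSpace.mk (c' 0)) ?_)
  exact congrArg (fun L : ℝ →L[ℝ] EN => L 1) h.mfderiv_eq

/-! ### The fibre derivative of the connection and the formula for `B(a, b)w` -/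

/-- The component along the fibres of a lift `ξ`, over the fibre `E_m ≃ F`. -/
def vertComp (ξ : ∀ a : TotalSpace F E, TangentSpace I a.proj → TangentSpace (I.prod 𝓘(ℝ, F)) a)
    (m : M) (v : EB) (y : F) : F :=
  (show EB × F from ξ ⟨m, ((trivializationAt F E m).continuousLinearEquivAt ℝ m
    (mem_baseSet_trivializationAt F E m)).symm y⟩ (show TangentSpace I m from v)).2

/-- The derivative of the component along the fibres of a lift `ξ` at `a` in the direction `b`,
for `a, b ∈ E_m`. -/
def fibreDeriv (ξ : ∀ a : TotalSpace F E, TangentSpace I a.proj → TangentSpace (I.prod 𝓘(ℝ, F)) a)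
    (m : M) (a b : E m) (v : EB) : F :=
  fderiv ℝ (vertComp ξ m v) (trivializationAt F E m ⟨m, a⟩).2 (trivializationAt F E m ⟨m, b⟩).2

lemma contMDiff_mk_symm (m : M) : ContMDiff 𝓘(ℝ, F) (I.prod 𝓘(ℝ, F)) ∞
    (fun y : F => (⟨m, ((trivializationAt F E m).continuousLinearEquivAt ℝ m
      (mem_baseSet_trivializationAt F E m)).symm y⟩ : TotalSpace F E)) := by
  intro y
  refine contMDiffAt_totalSpace.2 ⟨contMDiffAt_const, ?_⟩
  exact contMDiffAt_id.congr_of_eventuallyEq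
    (.of_forall fun y => ((trivializationAt F E m).continuousLinearEquivAt ℝ m
      (mem_baseSet_trivializationAt F E m)).apply_symm_apply y)

lemma contMDiff_pullTM_mk_symm (m : M) (v : TangentSpace I m) :
    ContMDiff 𝓘(ℝ, F) ((I.prod 𝓘(ℝ, F)).prod 𝓘(ℝ, EB)) ∞
    (fun y : F => (⟨⟨m, ((trivializationAt F E m).continuousLinearEquivAt ℝ m
      (mem_baseSet_trivializationAt F E m)).symm y⟩, v⟩ : TotalSpace EB (PullTM I F E))) := by
  intro y
  refine contMDiffAt_totalSpace.2 ⟨contMDiff_mk_symm m y, ?_⟩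
  exact (contMDiffAt_const (c := (trivializationAt EB (TangentSpace I) m ⟨m, v⟩).2))

variable {C : Set (TotalSpace F E)}
  {ξ : ∀ a : TotalSpace F E, TangentSpace I a.proj → TangentSpace (I.prod 𝓘(ℝ, F)) a}

lemma contDiffAt_vertComp (hξ : IsConnectionOn I ξ C)
    (hCopen : ∀ m : M, IsOpen {b : E m | (⟨m, b⟩ : TotalSpace F E) ∈ C})
    {m : M} {a : E m} (ha : (⟨m, a⟩ : TotalSpace F E) ∈ C) (v : EB) :
    ContDiffAt ℝ ∞ (vertComp ξ m v) (trivializationAt F E m ⟨m, a⟩).2 := by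
  set e := (trivializationAt F E m).continuousLinearEquivAt ℝ m
    (mem_baseSet_trivializationAt F E m) with he
  have hea : (trivializationAt F E m ⟨m, a⟩).2 = e a := rfl
  rw [hea]
  -- Openness of `C` in the fibre turns smoothness within the domain of `ξ` into smoothness at an
  -- interior point of `F`.
  have hU : {y : F | (⟨m, e.symm y⟩ : TotalSpace F E) ∈ C} ∈ 𝓝 (e a) := by
    refine ((hCopen m).preimage e.symm.continuous).mem_nhds ?_
    simpa using ha
  have h1 := hξ.smooth ⟨⟨m, e.symm (e a)⟩, (show TangentSpace I m from v)⟩ (by simpa using ha)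
  have h2 := (ContMDiffWithinAt.comp (e a)
    (f := fun y : F => (⟨⟨m, e.symm y⟩, v⟩ : TotalSpace EB (PullTM I F E)))
    (s := {y : F | (⟨m, e.symm y⟩ : TotalSpace F E) ∈ C}) h1
    (contMDiff_pullTM_mk_symm m v (e a)).contMDiffWithinAt (fun y hy => hy)).contMDiffAt hU
  have h3 := (contMDiffAt_totalSpace.1 h2).2
  have h4 : ContMDiffAt 𝓘(ℝ, F) 𝓘(ℝ, EB × F) ∞ (fun y : F =>
      (show EB × F from ξ ⟨m, e.symm y⟩ (show TangentSpace I m from v))) (e a) := by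
    refine h3.congr_of_eventuallyEq (.of_forall fun y => ?_)
    exact (trivializationAt_tangentSpace_tangentMk m (e.symm (e a)) (e.symm y) _ _).symm
  exact h4.contDiffAt.snd

lemma hasDerivAt_lift_snd (hξ : IsConnectionOn I ξ C)
    (hCopen : ∀ m : M, IsOpen {b : E m | (⟨m, b⟩ : TotalSpace F E) ∈ C})
    {m : M} {a : E m} (ha : (⟨m, a⟩ : TotalSpace F E) ∈ C) (b : E m) (v : EB) :
    HasDerivAt (fun s : ℝ => (show EB × F from
      ξ ⟨m, a + s • b⟩ (show TangentSpace I m from v)).2) (fibreDeriv ξ m a b v) 0 := by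
  set e := (trivializationAt F E m).continuousLinearEquivAt ℝ m
    (mem_baseSet_trivializationAt F E m) with he
  -- The base point is written as the value at `s = 0` of the line `e a + s • e b`, the form the
  -- chain rule needs.
  have h1 : HasFDerivAt (vertComp ξ m v) (fderiv ℝ (vertComp ξ m v) (e a)) (e a + (0 : ℝ) • e b) := by
    rw [zero_smul, add_zero]
    exact ((contDiffAt_vertComp hξ hCopen ha v).differentiableAt (by simp)).hasFDerivAt
  have h2 := h1.comp_hasDerivAt (0 : ℝ) (hasDerivAt_add_smul (e a) (e b) 0)
  refine h2.congr_of_eventuallyEq (.of_forall fun s => ?_)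
  have h3 : e.symm (e a + s • e b) = a + s • b := by
    rw [← map_smul, ← map_add, e.symm_apply_apply]
  exact congrArg (fun c : E m => (show EB × F from
    ξ ⟨m, c⟩ (show TangentSpace I m from v)).2) h3.symm

lemma eventually_add_smul_mem
    (hCopen : ∀ m : M, IsOpen {b : E m | (⟨m, b⟩ : TotalSpace F E) ∈ C})
    {m : M} {a : E m} (ha : (⟨m, a⟩ : TotalSpace F E) ∈ C) (b : E m) :
    ∀ᶠ s : ℝ in 𝓝 0, (⟨m, a + s • b⟩ : TotalSpace F E) ∈ C := by
  set e := (trivializationAt F E m).continuousLinearEquivAt ℝ m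
    (mem_baseSet_trivializationAt F E m) with he
  have h3 : ∀ s : ℝ, e.symm (e a + s • e b) = a + s • b := fun s => by
    rw [← map_smul, ← map_add, e.symm_apply_apply]
  have h1 : Continuous fun s : ℝ => a + s • b := by
    simp only [← h3]
    fun_prop
  refine h1.continuousAt.eventually ((hCopen m).mem_nhds ?_)
  simpa using ha

/-- In coordinates `Tπ` is the first projection, so the splitting condition forces the base
component of `ξ(a, v)` to be `v`; only the fibre component carries information. -/
lemma IsConnectionOn.mk_eq_tangentMk (hξ : IsConnectionOn I ξ C) {a : TotalSpace F E} (ha : a ∈ C)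
    (v : TangentSpace I a.proj) :
    (⟨a, ξ a v⟩ : TangentBundle (I.prod 𝓘(ℝ, F)) (TotalSpace F E)) =
      tangentMk I a (show EB from v) (show EB × F from ξ a v).2 := by
  refine congrArg (TotalSpace.mk a) (Prod.ext ?_ rfl)
  refine Eq.trans ?_ (hξ.splits a ha v)
  exact congrArg (fun L : EB × F →L[ℝ] EB => L (ξ a v)) (hasMFDerivAt_proj I a).mfderiv.symm

lemma linCurve_eventuallyEq (hξ : IsConnectionOn I ξ C)
    (hCopen : ∀ m : M, IsOpen {b : E m | (⟨m, b⟩ : TotalSpace F E) ∈ C})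
    {m : M} {a : E m} (ha : (⟨m, a⟩ : TotalSpace F E) ∈ C) (b : E m)
    (w : TangentSpace (I.prod 𝓘(ℝ, F)) (⟨m, a⟩ : TotalSpace F E)) :
    linCurve I ξ ⟨m, a⟩ b w =ᶠ[𝓝 0] fun s : ℝ => tangentMk I ⟨m, a + s • b⟩
      (show EB × F from w).1 (show EB × F from
        ξ ⟨m, a + s • b⟩ (show TangentSpace I m from (show EB × F from w).1)).2 := by
  filter_upwards [eventually_add_smul_mem hCopen ha b] with s hs
  have hw : mfderiv (I.prod 𝓘(ℝ, F)) I (π F E) (⟨m, a⟩ : TotalSpace F E) w =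
      (show EB × F from w).1 :=
    congrArg (fun L : EB × F →L[ℝ] EB => L w) (hasMFDerivAt_proj I (⟨m, a⟩ : TotalSpace F E)).mfderiv
  unfold linCurve
  rw [hw]
  exact hξ.mk_eq_tangentMk hs _

lemma mdifferentiableAt_linCurve (hξ : IsConnectionOn I ξ C)
    (hCopen : ∀ m : M, IsOpen {b : E m | (⟨m, b⟩ : TotalSpace F E) ∈ C})
    {m : M} {a : E m} (ha : (⟨m, a⟩ : TotalSpace F E) ∈ C) (b : E m)
    (w : TangentSpace (I.prod 𝓘(ℝ, F)) (⟨m, a⟩ : TotalSpace F E)) :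
    MDifferentiableAt 𝓘(ℝ, ℝ) (I.prod 𝓘(ℝ, F)).tangent (linCurve I ξ ⟨m, a⟩ b w) 0 :=
  (mdifferentiableAt_tangentMk (hasDerivAt_trivialization_add_smul m a b 0)
    (hasDerivAt_lift_snd hξ hCopen ha b _)).congr_of_eventuallyEq
    (linCurve_eventuallyEq hξ hCopen ha b w)

lemma velocity_linCurve (hξ : IsConnectionOn I ξ C)
    (hCopen : ∀ m : M, IsOpen {b : E m | (⟨m, b⟩ : TotalSpace F E) ∈ C})
    {m : M} {a : E m} (ha : (⟨m, a⟩ : TotalSpace F E) ∈ C) (b : E m)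
    (w : TangentSpace (I.prod 𝓘(ℝ, F)) (⟨m, a⟩ : TotalSpace F E)) :
    velocity (I.prod 𝓘(ℝ, F)).tangent (linCurve I ξ ⟨m, a⟩ b w) =
      tangentMk (I.prod 𝓘(ℝ, F)) (tangentMk I ⟨m, a⟩ (show EB × F from w).1
        (show EB × F from ξ ⟨m, a⟩ (show TangentSpace I m from (show EB × F from w).1)).2)
        (0, (trivializationAt F E m ⟨m, b⟩).2)
        (0, fibreDeriv ξ m a b (show EB × F from w).1) := by
  rw [velocity_congr (linCurve_eventuallyEq hξ hCopen ha b w)]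
  refine (velocity_tangentMk (a := fun s : ℝ => a + s • b)
    (hasDerivAt_trivialization_add_smul m a b 0)
    (hasDerivAt_lift_snd hξ hCopen ha b (show EB × F from w).1)).trans ?_
  have h0 : a + (0 : ℝ) • b = a := by rw [zero_smul, add_zero]
  rw [h0]

lemma linB_eq (hξ : IsConnectionOn I ξ C)
    (hCopen : ∀ m : M, IsOpen {b : E m | (⟨m, b⟩ : TotalSpace F E) ∈ C})
    {m : M} {a : E m} (ha : (⟨m, a⟩ : TotalSpace F E) ∈ C) (b : E m)
    (w : TangentSpace (I.prod 𝓘(ℝ, F)) (⟨m, a⟩ : TotalSpace F E)) :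
    linB I ξ ⟨m, a⟩ b w =
      tangentMk I ⟨m, b⟩ (show EB × F from w).1 (fibreDeriv ξ m a b (show EB × F from w).1) := by
  unfold linB
  rw [velocity_linCurve hξ hCopen ha b w, verticalProjT_tangentMk]

lemma existsUnique_isVerticalLiftOf (hξ : IsConnectionOn I ξ C)
    (hCopen : ∀ m : M, IsOpen {b : E m | (⟨m, b⟩ : TotalSpace F E) ∈ C})
    {m : M} {a : E m} (ha : (⟨m, a⟩ : TotalSpace F E) ∈ C) (b : E m)
    (w : TangentSpace (I.prod 𝓘(ℝ, F)) (⟨m, a⟩ : TotalSpace F E)) :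
    ∃! u, IsVerticalLiftOf I F E
      (velocity (I.prod 𝓘(ℝ, F)).tangent (linCurve I ξ ⟨m, a⟩ b w)) u := by
  rw [velocity_linCurve hξ hCopen ha b w]
  exact ⟨_, isVerticalLiftOf_tangentMk_iff.2 rfl, fun u hu => isVerticalLiftOf_tangentMk_iff.1 hu⟩

/-- The vectors `w` and `B(a, b)w` have the same base component, so together they form exactly one
tangent vector to `π^*E`. -/
lemma representsPair_linB_iff (hξ : IsConnectionOn I ξ C)
    (hCopen : ∀ m : M, IsOpen {b : E m | (⟨m, b⟩ : TotalSpace F E) ∈ C})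
    {p : TotalSpace F (PullE I F E)} (hp : p.proj ∈ C)
    (w : TangentSpace (I.prod 𝓘(ℝ, F)) p.proj)
    (W : TangentSpace ((I.prod 𝓘(ℝ, F)).prod 𝓘(ℝ, F)) p) :
    RepresentsPair I F E ⟨p, W⟩ ⟨p.proj, w⟩ (linB I ξ p.proj p.2 w) ↔
      W = (show (EB × F) × F from
        (w, fibreDeriv ξ p.proj.proj p.proj.2 p.2 (show EB × F from w).1)) := by
  obtain ⟨⟨m, a⟩, b⟩ := p
  rw [linB_eq hξ hCopen hp b w]
  refine (representsPair_tangentMk_iff (a := a) (b := b) (v := (show EB × F from w).1)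
    (α := (show EB × F from w).2)).trans ?_
  constructor
  · rintro ⟨-, h⟩
    exact (TotalSpace.mk_inj (F := (EB × F) × F) (E := (TangentSpace
      ((I.prod 𝓘(ℝ, F)).prod 𝓘(ℝ, F)) : TotalSpace F (PullE I F E) → Type _))).1 h
  · rintro rfl
    exact ⟨rfl, rfl⟩

/-- Over `C` the default value `0` in `linLift` is never reached. -/
lemma linLift_eq (hξ : IsConnectionOn I ξ C)
    (hCopen : ∀ m : M, IsOpen {b : E m | (⟨m, b⟩ : TotalSpace F E) ∈ C})
    {p : TotalSpace F (PullE I F E)} (hp : p.proj ∈ C)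
    (w : TangentSpace (I.prod 𝓘(ℝ, F)) p.proj) :
    linLift I ξ p w = (show (EB × F) × F from
        (w, fibreDeriv ξ p.proj.proj p.proj.2 p.2 (show EB × F from w).1)) := by
  have h : ∃ W : TangentSpace ((I.prod 𝓘(ℝ, F)).prod 𝓘(ℝ, F)) p,
      RepresentsPair I F E ⟨p, W⟩ ⟨p.proj, w⟩ (linB I ξ p.proj p.2 w) :=
    ⟨_, (representsPair_linB_iff hξ hCopen hp w _).2 rfl⟩
  unfold linLift
  rw [dif_pos h]
  exact (representsPair_linB_iff hξ hCopen hp w _).1 h.choose_spec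

lemma mk_linLift_eq_tangentMk (hξ : IsConnectionOn I ξ C)
    (hCopen : ∀ m : M, IsOpen {b : E m | (⟨m, b⟩ : TotalSpace F E) ∈ C})
    {a : TotalSpace F E} (ha : a ∈ C) (b : E a.proj) (w : TangentSpace (I.prod 𝓘(ℝ, F)) a) :
    (⟨⟨a, b⟩, linLift I ξ ⟨a, b⟩ w⟩ :
      TangentBundle ((I.prod 𝓘(ℝ, F)).prod 𝓘(ℝ, F)) (TotalSpace F (PullE I F E))) =
      tangentMk (I.prod 𝓘(ℝ, F)) (⟨a, b⟩ : TotalSpace F (PullE I F E)) (show EB × F from w)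
        (fibreDeriv ξ a.proj a.2 b (show EB × F from w).1) :=
  congrArg (TotalSpace.mk _) (linLift_eq hξ hCopen (p := ⟨a, b⟩) ha w)

lemma fibreDeriv_add {m : M} (a b b' : E m) (v : EB) :
    fibreDeriv ξ m a (b + b') v = fibreDeriv ξ m a b v + fibreDeriv ξ m a b' v := by
  unfold fibreDeriv
  rw [← map_add]
  exact congrArg _ (((trivializationAt F E m).linear ℝ
    (mem_baseSet_trivializationAt F E m)).map_add b b')

lemma fibreDeriv_smul {m : M} (c : ℝ) (a b : E m) (v : EB) :
    fibreDeriv ξ m a (c • b) v = c • fibreDeriv ξ m a b v := by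
  unfold fibreDeriv
  rw [← map_smul]
  exact congrArg _ (((trivializationAt F E m).linear ℝ
    (mem_baseSet_trivializationAt F E m)).map_smul c b)

/-- For small `s` the point `a + s b` lies in `C`, where `ξ` is linear in `v`; uniqueness of
derivatives passes the linearity to the derivative at `s = 0`. -/
lemma isLinearMap_fibreDeriv (hξ : IsConnectionOn I ξ C)
    (hCopen : ∀ m : M, IsOpen {b : E m | (⟨m, b⟩ : TotalSpace F E) ∈ C})
    {m : M} {a : E m} (ha : (⟨m, a⟩ : TotalSpace F E) ∈ C) (b : E m) : IsLinearMap ℝ (fibreDeriv ξ m a b) where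
  map_add v v' := by
    refine (hasDerivAt_lift_snd hξ hCopen ha b (v + v')).unique
      (((hasDerivAt_lift_snd hξ hCopen ha b v).add
        (hasDerivAt_lift_snd hξ hCopen ha b v')).congr_of_eventuallyEq ?_)
    filter_upwards [eventually_add_smul_mem hCopen ha b] with s hs
    exact congrArg (fun u : EB × F => u.2) ((hξ.isLinearMap _ hs).map_add v v')
  map_smul c v := by
    refine (hasDerivAt_lift_snd hξ hCopen ha b (c • v)).unique
      (((hasDerivAt_lift_snd hξ hCopen ha b v).const_smul c).congr_of_eventuallyEq ?_)
    filter_upwards [eventually_add_smul_mem hCopen ha b] with s hs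
    exact congrArg (fun u : EB × F => u.2) ((hξ.isLinearMap _ hs).map_smul c v)

/-! ### Local retraction onto the domain -/

/-- A submanifold is locally a smooth retract of the ambient manifold. -/
lemma IsSubmanifold.exists_retraction
    {EN HN N : Type*} [NormedAddCommGroup EN] [NormedSpace ℝ EN]
    [TopologicalSpace HN] {J : ModelWithCorners ℝ EN HN} [J.Boundaryless] [TopologicalSpace N]
    [ChartedSpace HN N] [IsManifold J ∞ N] {S : Set N} (hS : IsSubmanifold J S) {x : N} (hx : x ∈ S) :
    ∃ ρ : N → N, ContMDiffAt J J ∞ ρ x ∧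
      ∀ᶠ y in 𝓝 x, ρ y ∈ S ∧ (y ∈ S → ρ y = y) := by
  obtain ⟨φ, hφ, hxφ, A, ⟨P, hP⟩, hA⟩ := hS x hx
  set ψ := φ.extend J with hψ
  -- `Q` is the continuous projection onto the complemented subspace `A`; the retraction is `Q`
  -- conjugated by the chart.
  set Q : EN →L[ℝ] EN := A.subtypeL.comp P with hQ
  have hQA : ∀ z ∈ A, Q z = z := fun z hz => congrArg Subtype.val (hP ⟨z, hz⟩)
  have hxψ : Q (ψ x) = ψ x := hQA _ ((hA x hxφ).1 hx)
  have hψx : ContMDiffAt J 𝓘(ℝ, EN) ∞ ψ x := φ.contMDiffAt_extend hφ hxφ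
  -- Without boundary the chart target is open, so projected points near `ψ x` can still be pulled
  -- back to the manifold.
  have htarget : ψ.target ∈ 𝓝 (Q (ψ x)) := by
    rw [hxψ]
    exact φ.isOpen_extend_target.mem_nhds (ψ.map_source (by rwa [φ.extend_source]))
  have hQψ : ContMDiffAt J 𝓘(ℝ, EN) ∞ (fun y => Q (ψ y)) x :=
    Q.contDiff.contMDiff.contMDiffAt.comp x hψx
  refine ⟨fun y => ψ.symm (Q (ψ y)), ?_, ?_⟩
  · have h1 : ContMDiffAt 𝓘(ℝ, EN) J ∞ ψ.symm (Q (ψ x)) := by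
      refine (contMDiffOn_extend_symm hφ).contMDiffAt ?_
      have : J '' φ.target = ψ.target := by
        rw [hψ, φ.extend_target, J.image_eq]
      rwa [this]
    exact h1.comp x hQψ
  · filter_upwards [φ.open_source.mem_nhds hxφ, hQψ.continuousAt.eventually htarget] with y hy hy'
    refine ⟨?_, fun hyS => ?_⟩
    · have h1 : ψ.symm (Q (ψ y)) ∈ φ.source := by
        have := ψ.map_target hy'
        rwa [hψ, φ.extend_source] at this
      rw [hA _ h1, ψ.right_inv hy']
      exact (P (ψ y)).2
    · rw [hQA _ ((hA y hy).1 hyS)]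
      exact φ.extend_left_inv hy

/-! ### Vertical components in a fixed trivialization -/

lemma mem_chartAt_totalSpace_source_iff {a y : TotalSpace F E} :
    y ∈ (chartAt (ModelProd HB F) a).source ↔
      y.proj ∈ (chartAt HB a.proj).source ∧ y.proj ∈ (trivializationAt F E a.proj).baseSet := by
  rw [FiberBundle.chartedSpace_chartAt]
  simp only [OpenPartialHomeomorph.trans_source, OpenPartialHomeomorph.prod_source,
    OpenPartialHomeomorph.refl_source, mem_inter_iff, mem_preimage, mem_prod, mem_univ, and_true,
    Trivialization.mem_source]
  constructor
  · rintro ⟨h1, h2⟩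
    rw [Trivialization.coe_coe, Trivialization.coe_fst' _ h1] at h2
    exact ⟨h2, h1⟩
  · rintro ⟨h1, h2⟩
    rw [Trivialization.coe_coe, Trivialization.coe_fst' _ h2]
    exact ⟨h2, h1⟩

variable (I) in
/-- The component along the fibres, in the trivialization of `E` at `m`, of a vector tangent
to `E`. -/
def trivVert (m : M) (V : TangentBundle (I.prod 𝓘(ℝ, F)) (TotalSpace F E)) : F :=
  (show TangentSpace (I.prod 𝓘(ℝ, F)) V.proj →L[ℝ] F from
    mfderiv (I.prod 𝓘(ℝ, F)) 𝓘(ℝ, F) (fun y => (trivializationAt F E m y).2) V.proj) V.2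

/-- The chart of `E` at `a` is the pair of the base chart after `π` and the fibre coordinate.
Differentiating each entry gives the two components. -/
lemma trivializationAt_tangent_totalSpace_snd {a : TotalSpace F E}
    {V : TangentBundle (I.prod 𝓘(ℝ, F)) (TotalSpace F E)}
    (hV : V.proj ∈ (chartAt (ModelProd HB F) a).source) :
    (trivializationAt (EB × F) (TangentSpace (I.prod 𝓘(ℝ, F))) a V).2 =
      ((trivializationAt EB (TangentSpace I) a.proj
        (tangentMap (I.prod 𝓘(ℝ, F)) I (π F E) V)).2, trivVert I a.proj V) := by
  obtain ⟨h1, h2⟩ := mem_chartAt_totalSpace_source_iff.1 hV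
  rw [trivializationAt_tangentSpace_snd hV, trivializationAt_tangentSpace_snd
    (V := tangentMap (I.prod 𝓘(ℝ, F)) I (π F E) V) h1]
  have hd : MDifferentiableAt (I.prod 𝓘(ℝ, F)) 𝓘(ℝ, EB × F) (extChartAt (I.prod 𝓘(ℝ, F)) a) V.proj :=
    mdifferentiableAt_extChartAt hV
  have hev : ∀ᶠ y in 𝓝 V.proj, extChartAt (I.prod 𝓘(ℝ, F)) a y =
      (extChartAt I a.proj y.proj, (trivializationAt F E a.proj y).2) := by
    filter_upwards [eventually_mem_baseSet_of_mem h2] with y hy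
    exact extChartAt_totalSpace_apply a.2 hy
  refine Prod.ext ?_ ?_
  · have e1 : (fun y => ContinuousLinearMap.fst ℝ EB F (extChartAt (I.prod 𝓘(ℝ, F)) a y))
        =ᶠ[𝓝 V.proj] (extChartAt I a.proj) ∘ (π F E) := by
      filter_upwards [hev] with y hy
      rw [hy]
      rfl
    have l1 := ((ContinuousLinearMap.fst ℝ EB F).hasMFDerivAt
      (x := extChartAt (I.prod 𝓘(ℝ, F)) a V.proj)).comp V.proj hd.hasMFDerivAt
    have l2 : MDifferentiableAt I 𝓘(ℝ, EB) (extChartAt I a.proj) V.proj.proj :=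
      mdifferentiableAt_extChartAt h1
    have l3 := l2.hasMFDerivAt.comp V.proj (hasMFDerivAt_proj I V.proj).mdifferentiableAt.hasMFDerivAt
    have l4 := l1.congr_of_eventuallyEq e1.symm
    exact congrArg (fun L : EB × F →L[ℝ] EB => L V.2) (hasMFDerivAt_unique l4 l3)
  · have e1 : (fun y => ContinuousLinearMap.snd ℝ EB F (extChartAt (I.prod 𝓘(ℝ, F)) a y))
        =ᶠ[𝓝 V.proj] fun y => (trivializationAt F E a.proj y).2 := by
      filter_upwards [hev] with y hy
      rw [hy]
      rfl
    have l1 := ((ContinuousLinearMap.snd ℝ EB F).hasMFDerivAt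
      (x := extChartAt (I.prod 𝓘(ℝ, F)) a V.proj)).comp V.proj hd.hasMFDerivAt
    have l4 := l1.congr_of_eventuallyEq e1.symm
    exact congrArg (fun L : EB × F →L[ℝ] F => L V.2) l4.mfderiv.symm

lemma mdifferentiableAt_trivialization_snd {m : M} {a : TotalSpace F E}
    (ha : a.proj ∈ (trivializationAt F E m).baseSet) :
    MDifferentiableAt (I.prod 𝓘(ℝ, F)) 𝓘(ℝ, F) (fun y => (trivializationAt F E m y).2) a :=
  (contMDiffAt_trivialization_snd ha).mdifferentiableAt (by simp)

lemma trivVert_tangentMap_pullSnd {m : M} {W : TangentBundle ((I.prod 𝓘(ℝ, F)).prod 𝓘(ℝ, F))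
      (TotalSpace F (PullE I F E))} {c : E m}
    (hW : W.proj.proj.proj ∈ (trivializationAt F E m).baseSet) :
    trivVert (I.prod 𝓘(ℝ, F)) (E := PullE I F E) (⟨m, c⟩ : TotalSpace F E) W =
      trivVert I m
        (tangentMap ((I.prod 𝓘(ℝ, F)).prod 𝓘(ℝ, F)) (I.prod 𝓘(ℝ, F)) (pullSnd I F E) W) := by
  have h := mfderiv_comp W.proj
    (mdifferentiableAt_trivialization_snd (I := I) (a := pullSnd I F E W.proj) hW)
    (hasMFDerivAt_pullSnd W.proj).mdifferentiableAt
  exact congrArg (fun L : (EB × F) × F →L[ℝ] F => L W.2) h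

/-- Differentiate, along `π^*E`, the additivity on fibres of the trivialization at `m₀`. The vectors
on the right are in the coordinates at `m`, so this says that the change of trivialization respects
`+_τ`. -/
lemma trivVert_tangentMk_add {m₀ m : M} (hm : m ∈ (trivializationAt F E m₀).baseSet)
    (a b : E m) (v : EB) (α β : F) :
    trivVert I m₀ (tangentMk I ⟨m, a + b⟩ v (α + β)) =
      trivVert I m₀ (tangentMk I ⟨m, a⟩ v α) + trivVert I m₀ (tangentMk I ⟨m, b⟩ v β) := by
  set p : TotalSpace F (PullE I F E) := ⟨⟨m, a⟩, b⟩ with hp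
  have h1 := (mdifferentiableAt_trivialization_snd (I := I) (m := m₀) (a := fibreAdd I F E p) hm
    ).hasMFDerivAt.comp p (hasMFDerivAt_fibreAdd p)
  have h2 := (mdifferentiableAt_trivialization_snd (I := I) (m := m₀) (a := p.proj) hm
    ).hasMFDerivAt.comp p (hasMFDerivAt_proj (I.prod 𝓘(ℝ, F)) p)
  have h3 := (mdifferentiableAt_trivialization_snd (I := I) (m := m₀) (a := pullSnd I F E p) hm
    ).hasMFDerivAt.comp p (hasMFDerivAt_pullSnd p)
  have h4 := (h2.add h3).congr_of_eventuallyEq (f₁ := (fun y => (trivializationAt F E m₀ y).2) ∘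
      (fibreAdd I F E)) (by
    filter_upwards [(contMDiff_pullSnd (I := I) (F := F) (E := E)).continuous.continuousAt.eventually
      (eventually_mem_baseSet_of_mem (a := pullSnd I F E p) hm)] with y hy
    exact trivialization_fibreAdd_snd hy)
  exact congrArg (fun L : (EB × F) × F →L[ℝ] F => L ((v, α), β)) (hasMFDerivAt_unique h1 h4)

lemma trivVert_tangentMk_smul {m₀ m : M} (hm : m ∈ (trivializationAt F E m₀).baseSet)
    (s : ℝ) (a : E m) (v : EB) (α : F) :
    trivVert I m₀ (tangentMk I ⟨m, s • a⟩ v (s • α)) =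
      s • trivVert I m₀ (tangentMk I ⟨m, a⟩ v α) := by
  set p : TotalSpace F E := ⟨m, a⟩ with hp
  have h1 := (mdifferentiableAt_trivialization_snd (I := I) (m := m₀) (a := fibreSMul F E s p) hm
    ).hasMFDerivAt.comp p (hasMFDerivAt_fibreSMul s p)
  have h2 := (mdifferentiableAt_trivialization_snd (I := I) (m := m₀) (a := p) hm
    ).hasMFDerivAt.const_smul s
  have h4 := h2.congr_of_eventuallyEq (f₁ := (fun y => (trivializationAt F E m₀ y).2) ∘
      (fibreSMul F E s)) (by
    filter_upwards [eventually_mem_baseSet_of_mem (a := p) hm] with y hy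
    exact trivialization_fibreSMul_snd s hy)
  exact congrArg (fun L : EB × F →L[ℝ] F => L (v, α)) (hasMFDerivAt_unique h1 h4)

lemma mdifferentiableAt_trivVert {m₀ : M} {V : TangentBundle (I.prod 𝓘(ℝ, F)) (TotalSpace F E)}
    {c : E m₀} (hV : V.proj ∈ (chartAt (ModelProd HB F) (⟨m₀, c⟩ : TotalSpace F E)).source) :
    MDifferentiableAt (I.prod 𝓘(ℝ, F)).tangent 𝓘(ℝ, F) (trivVert I m₀) V := by
  have h1 := mdifferentiableAt_trivialization_snd (I := I.prod 𝓘(ℝ, F))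
    (E := (TangentSpace (I.prod 𝓘(ℝ, F)) : TotalSpace F E → Type _))
    (m := (⟨m₀, c⟩ : TotalSpace F E)) (a := V) hV
  have h2 := ((ContinuousLinearMap.snd ℝ EB F).mdifferentiableAt).comp V h1
  refine h2.congr_of_eventuallyEq ?_
  filter_upwards [(FiberBundle.continuous_proj (EB × F) (TangentSpace (I.prod 𝓘(ℝ, F)) :
    TotalSpace F E → Type _)).continuousAt.eventually
    ((chartAt (ModelProd HB F) (⟨m₀, c⟩ : TotalSpace F E)).open_source.mem_nhds hV)] with U hU
  exact congrArg Prod.snd (trivializationAt_tangent_totalSpace_snd hU).symm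

/-- The derivative of `g` along a curve depends on the velocity alone, so a curve may be replaced by
another one with the same velocity. -/
lemma hasDerivAt_comp_velocity
    {EN HN N : Type*} [NormedAddCommGroup EN] [NormedSpace ℝ EN]
    [TopologicalSpace HN] {J : ModelWithCorners ℝ EN HN} [TopologicalSpace N] [ChartedSpace HN N]
    {c : ℝ → N} {g : N → F} (hg : MDifferentiableAt J 𝓘(ℝ, F) g (c 0))
    (hc : MDifferentiableAt 𝓘(ℝ, ℝ) J c 0) :
    HasDerivAt (fun s => g (c s))
      (show F from (tangentMap J 𝓘(ℝ, F) g (velocity J c)).2) 0 := by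
  have h : HasFDerivAt (fun s => g (c s))
      (show ℝ →L[ℝ] F from (mfderiv J 𝓘(ℝ, F) g (c 0)).comp (mfderiv 𝓘(ℝ, ℝ) J c 0)) 0 :=
    (hg.hasMFDerivAt.comp (0 : ℝ) hc.hasMFDerivAt).hasFDerivAt
  exact h.hasDerivAt

/-- Replacing `α(s)` by `α(0) + s α'` does not change the velocity of the curve in `TE`. Along the
new curve `trivVert I m₀` is affine in `s`, by its compatibility with `+_τ` and `·_τ`, and its slope
is the stated value. -/
lemma hasDerivAt_trivVert {m₀ m : M} {c : E m₀}
    (hm : ∀ y : E m, (⟨m, y⟩ : TotalSpace F E) ∈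
      (chartAt (ModelProd HB F) (⟨m₀, c⟩ : TotalSpace F E)).source)
    (a b : E m) (v : EB) {α : ℝ → F} {α' : F} (hα : HasDerivAt α α' 0) :
    HasDerivAt (fun s : ℝ => trivVert I m₀ (tangentMk I ⟨m, a + s • b⟩ v (α s)))
      (trivVert I m₀ (tangentMk I ⟨m, b⟩ v α')) 0 := by
  have hm' : m ∈ (trivializationAt F E m₀).baseSet := (mem_chartAt_totalSpace_source_iff.1 (hm a)).2
  have ha := hasDerivAt_trivialization_add_smul (F := F) m a b 0
  have hα₁ := hasDerivAt_add_smul (α 0) α' 0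
  have k1 := hasDerivAt_comp_velocity (J := (I.prod 𝓘(ℝ, F)).tangent)
    (c := fun s : ℝ => tangentMk I ⟨m, a + s • b⟩ v (α s))
    (mdifferentiableAt_trivVert (m₀ := m₀) (c := c) (hm _)) (mdifferentiableAt_tangentMk ha hα)
  have k2 := hasDerivAt_comp_velocity (J := (I.prod 𝓘(ℝ, F)).tangent)
    (c := fun s : ℝ => tangentMk I ⟨m, a + s • b⟩ v (α 0 + s • α'))
    (mdifferentiableAt_trivVert (m₀ := m₀) (c := c) (hm _)) (mdifferentiableAt_tangentMk ha hα₁)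
  have k3 : HasDerivAt (fun s : ℝ => trivVert I m₀ (tangentMk I ⟨m, a + s • b⟩ v (α 0 + s • α')))
      (trivVert I m₀ (tangentMk I ⟨m, b⟩ v α')) 0 := by
    simp only [trivVert_tangentMk_add hm', trivVert_tangentMk_smul hm']
    exact hasDerivAt_add_smul _ _ 0
  have hvel : velocity (I.prod 𝓘(ℝ, F)).tangent
        (fun s : ℝ => tangentMk I ⟨m, a + s • b⟩ v (α s)) =
      velocity (I.prod 𝓘(ℝ, F)).tangent
        (fun s : ℝ => tangentMk I ⟨m, a + s • b⟩ v (α 0 + s • α')) := by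
    rw [velocity_tangentMk (a := fun s : ℝ => a + s • b) ha hα,
      velocity_tangentMk (a := fun s : ℝ => a + s • b) (α := fun s : ℝ => α 0 + s • α') ha hα₁]
    simp only [zero_smul, add_zero]
  rw [← hvel] at k2
  rw [← k2.unique k3]
  exact k1

/-! ### Smooth local extension of the linearization -/

/-- This is smooth dependence of a partial derivative on parameters; source and target in the `s`
direction are vector spaces, so the tangent coordinate changes are trivial. -/
lemma contMDiffAt_deriv_param
    {EN HN N : Type*} [NormedAddCommGroup EN] [NormedSpace ℝ EN]
    [TopologicalSpace HN] {J : ModelWithCorners ℝ EN HN} [TopologicalSpace N] [ChartedSpace HN N]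
    [IsManifold J ∞ N] {G : N × ℝ → F} {x : N} {s₀ : ℝ}
    (hG : ContMDiffAt (J.prod 𝓘(ℝ, ℝ)) 𝓘(ℝ, F) ∞ G (x, s₀)) :
    ContMDiffAt J 𝓘(ℝ, F) ∞ (fun q => deriv (fun s => G (q, s)) s₀) x := by
  have h := ContMDiffAt.mfderiv (m := ∞) (fun q s => G (q, s)) (fun _ : N => s₀) hG
    contMDiffAt_const le_rfl
  have h1 : ContMDiffAt J 𝓘(ℝ, ℝ →L[ℝ] F) ∞ (fun q => fderiv ℝ (fun s => G (q, s)) s₀) x := by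
    refine h.congr_of_eventuallyEq (.of_forall fun q => ?_)
    refine Eq.trans mfderiv_eq_fderiv.symm (congrFun (inTangentCoordinates_model_space
      (I := 𝓘(ℝ, ℝ)) (I' := 𝓘(ℝ, F)) (fun _ : N => s₀) (fun q => G (q, s₀))
      (fun q => mfderiv 𝓘(ℝ, ℝ) 𝓘(ℝ, F) (fun s => G (q, s)) s₀) x) q).symm
  have h2 : ContMDiffAt J 𝓘(ℝ, F) ∞ (fun q => fderiv ℝ (fun s => G (q, s)) s₀ 1) x :=
    (ContinuousLinearMap.apply ℝ F (1 : ℝ)).contDiff.contMDiff.contMDiffAt.comp x h1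
  exact h2.congr_of_eventuallyEq (.of_forall fun q => fderiv_apply_one_eq_deriv.symm)

variable (I) in
/-- The point `a + s b` of `E`, for `(a, b) ∈ π^*E`. -/
def fibreAddSMul (p : TotalSpace F (PullE I F E)) (s : ℝ) : TotalSpace F E :=
  ⟨p.proj.proj, p.proj.2 + s • (show E p.proj.proj from p.2)⟩

lemma fibreAddSMul_zero (p : TotalSpace F (PullE I F E)) : fibreAddSMul I p 0 = p.proj := by
  unfold fibreAddSMul
  rw [zero_smul, add_zero]

lemma trivialization_fibreAddSMul_snd {m : M} {y : TotalSpace F (PullE I F E)}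
    (hy : y.proj.proj ∈ (trivializationAt F E m).baseSet) (s : ℝ) :
    (trivializationAt F E m (fibreAddSMul I y s)).2 =
      (trivializationAt F E m y.proj).2 + s • (trivializationAt F E m (pullSnd I F E y)).2 := by
  have h := (trivializationAt F E m).linear ℝ hy
  exact (h.map_add _ _).trans (congrArg _ (h.map_smul _ _))

section Extension

variable {EN HN N : Type*} [NormedAddCommGroup EN] [NormedSpace ℝ EN]
  [TopologicalSpace HN] {J : ModelWithCorners ℝ EN HN} [TopologicalSpace N] [ChartedSpace HN N]
  {p : N → TotalSpace F (PullE I F E)} {x₀ : N}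

lemma contMDiffAt_fibreAddSMul
    (hp : ContMDiffAt J ((I.prod 𝓘(ℝ, F)).prod 𝓘(ℝ, F)) ∞ p x₀) (s₀ : ℝ) :
    ContMDiffAt (J.prod 𝓘(ℝ, ℝ)) (I.prod 𝓘(ℝ, F)) ∞
      (fun z : N × ℝ => fibreAddSMul I (p z.1) z.2) (x₀, s₀) := by
  have hp1 : ContMDiffAt (J.prod 𝓘(ℝ, ℝ)) ((I.prod 𝓘(ℝ, F)).prod 𝓘(ℝ, F)) ∞
      (fun z : N × ℝ => p z.1) (x₀, s₀) := ContMDiffAt.comp (x₀, s₀) (g := p) hp contMDiffAt_fst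
  have ha : ContMDiffAt (J.prod 𝓘(ℝ, ℝ)) (I.prod 𝓘(ℝ, F)) ∞
      (fun z : N × ℝ => (p z.1).proj) (x₀, s₀) :=
    (contMDiffAt_proj (PullE I F E)).comp (x₀, s₀) hp1
  have hb : ContMDiffAt (J.prod 𝓘(ℝ, ℝ)) (I.prod 𝓘(ℝ, F)) ∞
      (fun z : N × ℝ => pullSnd I F E (p z.1)) (x₀, s₀) :=
    contMDiff_pullSnd.contMDiffAt.comp (x₀, s₀) hp1
  have hm : ContMDiffAt (J.prod 𝓘(ℝ, ℝ)) I ∞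
      (fun z : N × ℝ => (p z.1).proj.proj) (x₀, s₀) :=
    (contMDiffAt_proj E).comp (x₀, s₀) ha
  refine contMDiffAt_totalSpace.2 ⟨hm, ?_⟩
  have hbase : (p x₀).proj.proj ∈ (trivializationAt F E (p x₀).proj.proj).baseSet :=
    mem_baseSet_trivializationAt F E _
  have h1 := (contMDiffAt_trivialization_snd (I := I) (a := (p x₀).proj) hbase).comp (x₀, s₀) ha
  have h2 := (contMDiffAt_trivialization_snd (I := I) (a := pullSnd I F E (p x₀)) hbase).comp
    (x₀, s₀) hb
  have h3 : ContMDiffAt (J.prod 𝓘(ℝ, ℝ)) 𝓘(ℝ, ℝ) ∞ (fun z : N × ℝ => z.2) (x₀, s₀) :=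
    contMDiffAt_snd
  refine (h1.add (h3.smul h2)).congr_of_eventuallyEq ?_
  filter_upwards [hm.continuousAt.eventually
    ((trivializationAt F E (p x₀).proj.proj).open_baseSet.mem_nhds hbase)] with z hz
  exact trivialization_fibreAddSMul_snd hz z.2

lemma continuous_fibreAddSMul (p : TotalSpace F (PullE I F E)) :
    Continuous (fibreAddSMul I p) := by
  refine continuous_iff_continuousAt.2 fun s => ?_
  have h := (contMDiffAt_fibreAddSMul (J := 𝓘(ℝ, ℝ)) (p := fun _ : ℝ => p) (x₀ := 0)
    contMDiffAt_const s).continuousAt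
  exact ContinuousAt.comp (f := fun s : ℝ => ((0 : ℝ), s)) h (by fun_prop)

variable {C : Set (TotalSpace F E)}
  {ξ : ∀ a : TotalSpace F E, TangentSpace I a.proj → TangentSpace (I.prod 𝓘(ℝ, F)) a}

lemma hasDerivAt_trivVert_lift (hξ : IsConnectionOn I ξ C)
    (hCopen : ∀ m : M, IsOpen {b : E m | (⟨m, b⟩ : TotalSpace F E) ∈ C})
    {a₀ : TotalSpace F E} {q : TotalSpace F (PullE I F E)} (hq : q.proj ∈ C)
    (hq' : q.proj ∈ (chartAt (ModelProd HB F) a₀).source) (v : TangentSpace I q.proj.proj) :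
    HasDerivAt (fun s : ℝ => trivVert I a₀.proj ⟨fibreAddSMul I q s, ξ (fibreAddSMul I q s) v⟩)
      (trivVert I a₀.proj (tangentMk I (pullSnd I F E q) v
        (fibreDeriv ξ q.proj.proj q.proj.2 q.2 v))) 0 := by
  obtain ⟨⟨m, a⟩, b⟩ := q
  obtain ⟨m₀, c⟩ := a₀
  have hq'' := mem_chartAt_totalSpace_source_iff.1 hq'
  have hm : ∀ y : E m, (⟨m, y⟩ : TotalSpace F E) ∈
      (chartAt (ModelProd HB F) (⟨m₀, c⟩ : TotalSpace F E)).source := fun y =>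
    mem_chartAt_totalSpace_source_iff.2 ⟨hq''.1, hq''.2⟩
  refine (hasDerivAt_trivVert hm a b (show EB from v)
    (hasDerivAt_lift_snd hξ hCopen hq b (show EB from v))).congr_of_eventuallyEq ?_
  filter_upwards [eventually_add_smul_mem hCopen hq b] with s hs
  exact congrArg (trivVert I m₀) (hξ.mk_eq_tangentMk hs v)

/-- The linearization of a connection with domain a submanifold `C` extends locally to a smooth
map on a neighbourhood of `C`. -/
lemma exists_contMDiffAt_eq_trivVert [I.Boundaryless] [IsManifold J ∞ N]
    (hC : IsSubmanifold (I.prod 𝓘(ℝ, F)) C) (hξ : IsConnectionOn I ξ C)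
    (hCopen : ∀ m : M, IsOpen {b : E m | (⟨m, b⟩ : TotalSpace F E) ∈ C})
    (hp : ContMDiffAt J ((I.prod 𝓘(ℝ, F)).prod 𝓘(ℝ, F)) ∞ p x₀) (hpC : (p x₀).proj ∈ C)
    {t : N → EB} (ht : ContMDiffAt J 𝓘(ℝ, EB) ∞ t x₀) :
    ∃ H : N → F, ContMDiffAt J 𝓘(ℝ, F) ∞ H x₀ ∧
      ∀ᶠ q in 𝓝 x₀, (p q).proj ∈ C → ∀ v : TangentSpace I (p q).proj.proj,
        (trivializationAt EB (TangentSpace I) (p x₀).proj.proj ⟨(p q).proj.proj, v⟩).2 = t q →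
        H q = trivVert I (p x₀).proj.proj (tangentMk I (pullSnd I F E (p q)) v
          (fibreDeriv ξ (p q).proj.proj (p q).proj.2 (p q).2 v)) := by
  obtain ⟨ρ, hρ, hρC⟩ := hC.exists_retraction hpC
  set a₀ := (p x₀).proj with ha₀
  set e := trivializationAt EB (TangentSpace I) a₀.proj with he
  have hρa₀ : ρ a₀ = a₀ := hρC.self_of_nhds.2 hpC
  set A : N × ℝ → TotalSpace F E := fun z => fibreAddSMul I (p z.1) z.2 with hA
  have hA₀ : A (x₀, 0) = a₀ := fibreAddSMul_zero (p x₀)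
  have hAs : ContMDiffAt (J.prod 𝓘(ℝ, ℝ)) (I.prod 𝓘(ℝ, F)) ∞ A (x₀, 0) :=
    contMDiffAt_fibreAddSMul hp 0
  have hρA : ContMDiffAt (J.prod 𝓘(ℝ, ℝ)) (I.prod 𝓘(ℝ, F)) ∞ (fun z => ρ (A z)) (x₀, 0) :=
    ContMDiffAt.comp (x₀, 0) (g := ρ) (by rw [hA₀]; exact hρ) hAs
  have hρA₀ : ρ (A (x₀, 0)) = a₀ := by rw [hA₀, hρa₀]
  have hbase : ∀ᶠ z in 𝓝 ((x₀, 0) : N × ℝ), (ρ (A z)).proj ∈ e.baseSet := by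
    have h : Filter.Tendsto (fun z => ρ (A z)) (𝓝 (x₀, 0)) (𝓝 a₀) :=
      hρA₀ ▸ hρA.continuousAt.tendsto
    exact h.eventually <| (FiberBundle.continuous_proj F E).continuousAt.eventually
      (e.open_baseSet.mem_nhds (mem_baseSet_trivializationAt EB (TangentSpace I) a₀.proj))
  -- The retraction may move the base point, so the vector to be lifted is prescribed by its
  -- coordinates `t` in the trivialization of `TM` at the base point of `a₀`.
  set Q : N × ℝ → TotalSpace EB (PullTM I F E) :=
    fun z => ⟨ρ (A z), e.symm (ρ (A z)).proj (t z.1)⟩ with hQ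
  have hQs : ContMDiffAt (J.prod 𝓘(ℝ, ℝ)) ((I.prod 𝓘(ℝ, F)).prod 𝓘(ℝ, EB)) ∞ Q (x₀, 0) := by
    refine ((trivializationAt EB (PullTM I F E) a₀).contMDiffAt_iff ?_).2 ⟨hρA, ?_⟩
    · exact (Trivialization.mem_source _).2 hbase.self_of_nhds
    · have h1 : ContMDiffAt (J.prod 𝓘(ℝ, ℝ)) 𝓘(ℝ, EB) ∞ (fun z : N × ℝ => t z.1) (x₀, 0) :=
        ContMDiffAt.comp (x₀, 0) (g := t) ht contMDiffAt_fst
      refine h1.congr_of_eventuallyEq ?_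
      filter_upwards [hbase] with z hz
      exact congrArg Prod.snd (e.apply_mk_symm hz (t z.1))
  have hmaps : ∀ᶠ z in 𝓝 ((x₀, 0) : N × ℝ), ρ (A z) ∈ C := by
    have h : Filter.Tendsto A (𝓝 (x₀, 0)) (𝓝 a₀) := hA₀ ▸ hAs.continuousAt.tendsto
    exact h.eventually (hρC.mono fun y hy => hy.1)
  set Ξ : TotalSpace EB (PullTM I F E) → TangentBundle (I.prod 𝓘(ℝ, F)) (TotalSpace F E) :=
    fun q => ⟨q.proj, ξ q.proj q.2⟩ with hΞ
  have hΞQ : ContMDiffAt (J.prod 𝓘(ℝ, ℝ)) (I.prod 𝓘(ℝ, F)).tangent ∞ (fun z => Ξ (Q z))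
      (x₀, 0) :=
    (ContMDiffWithinAt.comp (x₀, 0) (f := Q) (g := Ξ) (s := {z | ρ (A z) ∈ C})
      (hξ.smooth (Q (x₀, 0)) hmaps.self_of_nhds) hQs.contMDiffWithinAt
      (fun z hz => hz)).contMDiffAt hmaps
  have hG := (((trivializationAt (EB × F) (TangentSpace (I.prod 𝓘(ℝ, F))) a₀).contMDiffAt_iff
    (f := fun z => Ξ (Q z)) (x₀ := ((x₀, 0) : N × ℝ)) (by
      rw [Trivialization.mem_source]
      exact hρA₀ ▸ mem_baseSet_trivializationAt (EB × F) (TangentSpace (I.prod 𝓘(ℝ, F))) _)).1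
        hΞQ).2
  have hG2 : ContMDiffAt (J.prod 𝓘(ℝ, ℝ)) 𝓘(ℝ, F) ∞ (fun z => (trivializationAt (EB × F)
      (TangentSpace (I.prod 𝓘(ℝ, F))) a₀ (Ξ (Q z))).2.2) (x₀, 0) :=
    (ContinuousLinearMap.snd ℝ EB F).contDiff.contMDiff.contMDiffAt.comp (x₀, 0) hG
  -- `H q` is the derivative at `s = 0` of the vertical component of `ξ` along `Q (q, s)`.
  refine ⟨_, contMDiffAt_deriv_param hG2, ?_⟩
  have hpc : ContinuousAt (fun q => (p q).proj) x₀ :=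
    ((FiberBundle.continuous_proj F (PullE I F E)).continuousAt).comp hp.continuousAt
  -- The retraction property is needed on a whole neighbourhood of `(p q).proj`, since the
  -- derivative at `q` involves the points `a + s b` for all small `s`.
  filter_upwards [hpc.eventually (eventually_eventually_nhds.2 hρC),
    hpc.eventually ((chartAt (ModelProd HB F) a₀).open_source.mem_nhds
      (mem_chart_source (ModelProd HB F) a₀))] with q hq1 hq2 hqC v hv
  refine HasDerivAt.deriv ?_
  refine (hasDerivAt_trivVert_lift hξ hCopen hqC hq2 v).congr_of_eventuallyEq ?_
  have hc : ∀ᶠ s in 𝓝 (0 : ℝ), fibreAddSMul I (p q) s ∈ C →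
      ρ (fibreAddSMul I (p q) s) = fibreAddSMul I (p q) s := by
    have h : Filter.Tendsto (fibreAddSMul I (p q)) (𝓝 0) (𝓝 (p q).proj) :=
      fibreAddSMul_zero (p q) ▸ (continuous_fibreAddSMul (p q)).continuousAt.tendsto
    exact h.eventually (hq1.mono fun y hy => hy.2)
  filter_upwards [hc, eventually_add_smul_mem hCopen (m := (p q).proj.proj) (a := (p q).proj.2)
    hqC (p q).2] with s hs1 hs2
  have hs3 := hs1 hs2
  have hqm := mem_chartAt_totalSpace_source_iff.1 hq2
  have hQz : Q (q, s) = ⟨fibreAddSMul I (p q) s, v⟩ := by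
    have key : ∀ y : TotalSpace F E, y = fibreAddSMul I (p q) s →
        (⟨y, e.symm y.proj (t q)⟩ : TotalSpace EB (PullTM I F E)) =
          ⟨fibreAddSMul I (p q) s, v⟩ := by
      rintro _ rfl
      refine congrArg (TotalSpace.mk _) ?_
      rw [← hv]
      exact e.symm_apply_apply_mk hqm.1 v
    exact key _ hs3
  have hGz : (trivializationAt (EB × F) (TangentSpace (I.prod 𝓘(ℝ, F))) a₀ (Ξ (Q (q, s)))).2.2 =
      trivVert I a₀.proj (Ξ (Q (q, s))) := by
    refine congrArg Prod.snd (trivializationAt_tangent_totalSpace_snd (a := a₀) ?_)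
    rw [hQz]
    exact mem_chartAt_totalSpace_source_iff.2 hqm
  exact hGz.trans (by rw [hQz])

end Extension

lemma contMDiff_pullTM_lift : ContMDiff ((I.prod 𝓘(ℝ, F)).prod 𝓘(ℝ, EB)) I.tangent ∞
    (fun q : TotalSpace EB (PullTM I F E) => (⟨q.proj.proj, q.2⟩ : TangentBundle I M)) := by
  intro q
  have h := contMDiffAt_totalSpace.1 (contMDiffAt_id (I := (I.prod 𝓘(ℝ, F)).prod 𝓘(ℝ, EB))
    (n := ∞) (x := q))
  have h1 : ContMDiffAt ((I.prod 𝓘(ℝ, F)).prod 𝓘(ℝ, EB)) I ∞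
      (fun y : TotalSpace EB (PullTM I F E) => (π F E) y.proj) q :=
    (contMDiffAt_proj E).comp q h.1
  exact contMDiffAt_totalSpace.2 ⟨h1, h.2⟩

/-- In the trivialization at `q₀` the lift has two components. The first is the coordinate of `w`,
smooth everywhere; the second is the vertical component of `B(a, b)w`, which on the domain agrees
with a smooth function defined near `q₀`. -/
lemma contMDiffOn_linLift [I.Boundaryless] {C : Set (TotalSpace F E)}
    {ξ : ∀ a : TotalSpace F E, TangentSpace I a.proj → TangentSpace (I.prod 𝓘(ℝ, F)) a}
    (hC : IsSubmanifold (I.prod 𝓘(ℝ, F)) C) (hξ : IsConnectionOn I ξ C)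
    (hCopen : ∀ m : M, IsOpen {b : E m | (⟨m, b⟩ : TotalSpace F E) ∈ C}) :
    ContMDiffOn (((I.prod 𝓘(ℝ, F)).prod 𝓘(ℝ, F)).prod 𝓘(ℝ, EB × F))
      ((I.prod 𝓘(ℝ, F)).prod 𝓘(ℝ, F)).tangent ∞
      (fun q : TotalSpace (EB × F) (PullTM (I.prod 𝓘(ℝ, F)) F (PullE I F E)) =>
        (⟨q.proj, linLift I ξ q.proj q.2⟩ :
          TangentBundle ((I.prod 𝓘(ℝ, F)).prod 𝓘(ℝ, F)) (TotalSpace F (PullE I F E))))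
      {q | q.proj.proj ∈ C} := by
  intro q₀ hq₀
  set 𝓙 := ((I.prod 𝓘(ℝ, F)).prod 𝓘(ℝ, F)).prod 𝓘(ℝ, EB × F) with h𝓙
  have hproj : ContMDiffAt 𝓙 ((I.prod 𝓘(ℝ, F)).prod 𝓘(ℝ, F)) ∞
      (fun q : TotalSpace (EB × F) (PullTM (I.prod 𝓘(ℝ, F)) F (PullE I F E)) => q.proj) q₀ :=
    contMDiffAt_proj _
  refine contMDiffWithinAt_totalSpace.2 ⟨hproj.contMDiffWithinAt, ?_⟩
  have hlift : ContMDiffAt 𝓙 (I.prod 𝓘(ℝ, F)).tangent ∞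
      (fun q : TotalSpace (EB × F) (PullTM (I.prod 𝓘(ℝ, F)) F (PullE I F E)) =>
        (⟨q.proj.proj, q.2⟩ : TangentBundle (I.prod 𝓘(ℝ, F)) (TotalSpace F E))) q₀ :=
    contMDiff_pullTM_lift q₀
  have hw := (contMDiffAt_totalSpace.1 hlift).2
  have hTπ : ContMDiffAt 𝓙 I.tangent ∞
      (fun q : TotalSpace (EB × F) (PullTM (I.prod 𝓘(ℝ, F)) F (PullE I F E)) =>
        tangentMap (I.prod 𝓘(ℝ, F)) I (π F E) ⟨q.proj.proj, q.2⟩) q₀ :=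
    ((contMDiff_proj E).contMDiff_tangentMap le_rfl).contMDiffAt.comp q₀ hlift
  -- The coordinates of `Tπ(w)` serve as the function `t` of the extension lemma, with the bundle
  -- projection as `p`.
  have ht := (contMDiffAt_totalSpace.1 hTπ).2
  obtain ⟨H, hH, hHeq⟩ := exists_contMDiffAt_eq_trivVert hC hξ hCopen hproj hq₀ ht
  refine ((hw.prodMk_space hH).contMDiffWithinAt).congr_of_eventuallyEq_of_mem ?_ hq₀
  have hsrc : ∀ᶠ q in 𝓝 q₀, q.proj ∈ (chartAt (ModelProd (ModelProd HB F) F) q₀.proj).source :=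
    hproj.continuousAt.eventually 
      ((chartAt (ModelProd (ModelProd HB F) F) q₀.proj).open_source.mem_nhds
        (mem_chart_source (ModelProd (ModelProd HB F) F) q₀.proj))
  filter_upwards [nhdsWithin_le_nhds hHeq, nhdsWithin_le_nhds hsrc, self_mem_nhdsWithin]
    with q hq1 hq2 hq3
  have hsrc1 := mem_chartAt_totalSpace_source_iff.1 hq2
  have hsrc2 := mem_chartAt_totalSpace_source_iff.1 hsrc1.1
  have hW := mk_linLift_eq_tangentMk hξ hCopen hq3 q.proj.2 q.2
  refine (trivializationAt_tangent_totalSpace_snd (I := I.prod 𝓘(ℝ, F)) (E := PullE I F E)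
    (a := q₀.proj) (V := ⟨q.proj, linLift I ξ q.proj q.2⟩) hq2).trans (Prod.ext ?_ ?_)
  · refine congrArg (fun V => (trivializationAt (EB × F) (TangentSpace (I.prod 𝓘(ℝ, F)))
      q₀.proj.proj V).2) ?_
    exact (congrArg _ hW).trans (tangentMap_proj_tangentMk (I := I.prod 𝓘(ℝ, F)) q.proj _ _)
  · refine Eq.trans ?_ (hq1 hq3 (show EB × F from q.2).1 ?_).symm
    · refine (trivVert_tangentMap_pullSnd (c := q₀.proj.proj.2) hsrc2.2).trans ?_
      refine congrArg (trivVert I q₀.proj.proj.proj) ?_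
      exact (congrArg _ hW).trans (tangentMap_pullSnd_tangentMk q.proj _ _ _)
    · exact congrArg (fun V => (trivializationAt EB (TangentSpace I) q₀.proj.proj.proj V).2)
        (tangentMap_proj_tangentMk q.proj.proj _ _).symm

/-! ### The linearized connection -/

lemma isLinearConnectionOn_linLift [I.Boundaryless] {C : Set (TotalSpace F E)}
    {ξ : ∀ a : TotalSpace F E, TangentSpace I a.proj → TangentSpace (I.prod 𝓘(ℝ, F)) a}
    (hC : IsSubmanifold (I.prod 𝓘(ℝ, F)) C) (hξ : IsConnectionOn I ξ C)
    (hCopen : ∀ m : M, IsOpen {b : E m | (⟨m, b⟩ : TotalSpace F E) ∈ C}) :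
    IsLinearConnectionOn (I.prod 𝓘(ℝ, F)) (F := F) (E := PullE I F E) (linLift I ξ) C where
  isLinearMap := by
    intro p hp
    have hlin := isLinearMap_fibreDeriv hξ hCopen (m := p.proj.proj) (a := p.proj.2) hp p.2
    refine ⟨fun w w' => ?_, fun c w => ?_⟩
    · rw [linLift_eq hξ hCopen hp, linLift_eq hξ hCopen hp, linLift_eq hξ hCopen hp]
      exact Prod.ext rfl (hlin.map_add _ _)
    · rw [linLift_eq hξ hCopen hp, linLift_eq hξ hCopen hp]
      exact Prod.ext rfl (hlin.map_smul _ _)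
  splits := by
    intro p hp w
    rw [linLift_eq hξ hCopen hp]
    exact congrArg (fun L : (EB × F) × F →L[ℝ] EB × F => L (w, fibreDeriv ξ p.proj.proj p.proj.2 p.2
      (show EB × F from w).1)) (hasMFDerivAt_proj (I.prod 𝓘(ℝ, F)) p).mfderiv
  smooth := contMDiffOn_linLift hC hξ hCopen
  map_add := by
    intro a ha b b' w
    refine (mk_linLift_eq_tangentMk hξ hCopen ha (b + b') w).trans <| Eq.trans ?_ <|
      (tauAdd_tangentMk (I := I.prod 𝓘(ℝ, F)) (E := PullE I F E) b b' (show EB × F from w)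
        (fibreDeriv ξ a.proj a.2 b (show EB × F from w).1)
        (fibreDeriv ξ a.proj a.2 b' (show EB × F from w).1)).symm.trans <|
      congrArg₂ (tauAdd (I.prod 𝓘(ℝ, F)) F (PullE I F E))
        (mk_linLift_eq_tangentMk hξ hCopen ha b w).symm
        (mk_linLift_eq_tangentMk hξ hCopen ha b' w).symm
    exact congrArg _ (fibreDeriv_add a.2 b b' _)
  map_smul := by
    intro a ha c b w
    refine (mk_linLift_eq_tangentMk hξ hCopen ha (c • b) w).trans <| Eq.trans ?_ <|
      (tauSMul_tangentMk (I := I.prod 𝓘(ℝ, F)) (E := PullE I F E) c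
        (⟨a, b⟩ : TotalSpace F (PullE I F E)) (show EB × F from w)
        (fibreDeriv ξ a.proj a.2 b (show EB × F from w).1)).symm.trans <|
      congrArg (tauSMul (I.prod 𝓘(ℝ, F)) F (PullE I F E) c)
        (mk_linLift_eq_tangentMk hξ hCopen ha b w).symm
    exact congrArg _ (fibreDeriv_smul c a.2 b _)

end VectorBundle
end

theorem theorem3p2
    {EB : Type*} [NormedAddCommGroup EB] [NormedSpace ℝ EB] [CompleteSpace EB]
    {HB : Type*} [TopologicalSpace HB] (I : ModelWithCorners ℝ EB HB) [I.Boundaryless]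
    {M : Type*} [TopologicalSpace M] [ChartedSpace HB M] [IsManifold I ∞ M]
    {F : Type*} [NormedAddCommGroup F] [NormedSpace ℝ F] [CompleteSpace F]
    {E : M → Type*} [∀ x, AddCommMonoid (E x)] [∀ x, Module ℝ (E x)]
    [TopologicalSpace (TotalSpace F E)] [∀ x, TopologicalSpace (E x)]
    [FiberBundle F E] [VectorBundle ℝ F E] [ContMDiffVectorBundle ∞ F E I]
    (C : Set (TotalSpace F E)) (hC : IsSubmanifold (I.prod 𝓘(ℝ, F)) C)
    (hCne : ∀ m : M, {b : E m | (⟨m, b⟩ : TotalSpace F E) ∈ C}.Nonempty)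
    (hCopen : ∀ m : M, IsOpen {b : E m | (⟨m, b⟩ : TotalSpace F E) ∈ C})
    (ξ : ∀ a : TotalSpace F E, TangentSpace I a.proj → TangentSpace (I.prod 𝓘(ℝ, F)) a)
    (hξ : IsConnectionOn I ξ C) :
    -- `B(a, b)w` is well defined, is tangent to `E` at `b`, and projects to `Tπ(w)`
    (∀ a ∈ C, ∀ (b : E a.proj) (w : TangentSpace (I.prod 𝓘(ℝ, F)) a),
      MDifferentiableAt 𝓘(ℝ, ℝ) (I.prod 𝓘(ℝ, F)).tangent (linCurve I ξ a b w) 0 ∧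
      (∃! u, IsVerticalLiftOf I F E
        (velocity (I.prod 𝓘(ℝ, F)).tangent (linCurve I ξ a b w)) u) ∧
      (linB I ξ a b w).proj = ⟨a.proj, b⟩ ∧
      tangentMap (I.prod 𝓘(ℝ, F)) I (π F E) (linB I ξ a b w) =
        tangentMap (I.prod 𝓘(ℝ, F)) I (π F E) ⟨a, w⟩) ∧
    -- `(w, B(a, b)w)` is a well-defined tangent vector to `π^*E` at `(a, b)`
    (∀ p : TotalSpace F (PullE I F E), p.proj ∈ C →
      ∀ w : TangentSpace (I.prod 𝓘(ℝ, F)) p.proj,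
        ∃! W : TangentSpace ((I.prod 𝓘(ℝ, F)).prod 𝓘(ℝ, F)) p,
          RepresentsPair I F E ⟨p, W⟩ ⟨p.proj, w⟩ (linB I ξ p.proj p.2 w)) ∧
    -- `((a, b), w) ↦ (w, B(a, b)w)` is the lift of a linear connection with domain `π_C^*E`
    IsLinearConnectionOn (I.prod 𝓘(ℝ, F)) (F := F) (E := PullE I F E) (linLift I ξ) C := by
  refine ⟨?_, ?_, isLinearConnectionOn_linLift hC hξ hCopen⟩
  · rintro ⟨m, a⟩ ha b w
    refine ⟨mdifferentiableAt_linCurve hξ hCopen ha b w,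
      existsUnique_isVerticalLiftOf hξ hCopen ha b w, ?_, ?_⟩
    · exact congrArg TotalSpace.proj (linB_eq hξ hCopen ha b w)
    · rw [linB_eq hξ hCopen ha b w, tangentMap_proj_tangentMk]
      exact (tangentMap_proj_tangentMk (⟨m, a⟩ : TotalSpace F E) (show EB × F from w).1
        (show EB × F from w).2).symm
  · intro p hp w
    exact ⟨_, (representsPair_linB_iff hξ hCopen hp w _).2 rfl,
      fun W hW => (representsPair_linB_iff hξ hCopen hp w W).1 hW⟩
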